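/- Consider $\min_{x\in\mathbb R^d}\max_{y\in Y} f(x,y)$ with $Y\subseteq\mathbb R^{d'}$ closed and convex, $d+d'\ge 1$, where $f$ is differentiable in $x$ and in $y$ at every point of $\mathbb R^d\times Y$. Put $P(x)=\max_{y\in Y}f(x,y)$ and $\mathrm{Gap}(x,y)=\max_{y'\in Y}f(x,y')-\min_{x'}f(x',y)$. Say that a differentiable $h$ on $\mathbb R^d$ is $\mu$-PL if it has a global minimiser $x_*$ and $\|\nabla h(x)\|^2\ge 2\mu\,(h(x)-h(x_*))$ for all $x$. Assume: * $(\nabla_x f,-\nabla_y f)$ is $\ell$-Lipschitz on $\mathbb R^d\times Y$; $f(x,\cdot)$ is $\mu_y$-strongly concave on $Y$ for every $x$; $f(\cdot,y)$ is $\rho$-weakly convex for every $y\in Y$, with $0<\rho\le\ell$; * $P$ is $L$-smooth and $\mu$-PL, with $0<\mu\le L$ (the inequality is automatic unless $P$ is constant); * $f(\cdot,y)$ is $\mu_x$-PL for every $y\in Y$; * a point $x_0\in\mathbb R^d$, $y_0\in Y$ with $\mathrm{Gap}(x_0,y_0)\le\epsilon_0$ is given. A stochastic oracle gives $\mathcal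 G_x(x,y;\xi),\mathcal G_y(x,y;\xi)$, jointly measurable in $(x,y,\xi)$, with independent samples $\xi$ and expectations $\nabla_x f(x,y),\nabla_y f(x,y)$ for all $(x,y)\in\mathbb R^d\times Y$. PES-AdaGrad runs epochs $k=1,\dots,K$. Epoch $k$ starts from $z_1=z_0=(x_{k-1},y_{k-1})$ and runs $T_k$ AdaGrad iterations on $f_k(x,y)=f(x,y)+\frac{\gamma}{2}\|x-x_{k-1}\|^2$ with $\gamma=2\rho$: for $t=1,\dots,T_k$, with the stochastic gradient $\mathcal G_t=(\mathcal G_x(z_t;\xi^k_t)+\gamma(x_t-x_{k-1}),\,-\mathcal G_y(z_t;\xi^k_t))$, with $g^k_{1:t}=[\mathcal G_1,\dots,\mathcal G_t]$ ($i$-th row $g^k_{1:t,i}$), $s_{t,i}=\|g^k_{1:t,i}\|_2$ and $H_t=\delta I+\mathrm{diag}(s_t)$, $$z_{t+1}=\arg\min_{z\in\mathbb R^d\times Y}\ \eta_k\Big\langle z,\tfrac1t\sum_{\tau\le t}\mathcal G_\tau\Big\rangle+\tfrac1{2t}\langle z-z_0,H_t(z-z_0)\rangle ;$$ it outputs $(x_k,y_k)=\frac1{T_k}\sum_{t=1}^{T_k}z_t$.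 With $c=4\rho+\frac{248}{53}(L+2\rho)$ the schedule is $$\eta_k=\eta_0\exp\Big(-\frac{k-1}{2}\cdot\frac{2\mu}{c+2\mu}\Big),\qquad T_k=\Big\lceil\Big(\frac{A\,\delta}{\eta_k\min\{\rho,\mu_y\}}\Big)^{\frac1{1-\alpha}}\Big\rceil .$$ There are absolute constants $A,C>0$ and $p\in\mathbb N$ with the following property. Let $d,d'$ with $d+d'\ge1$, $\rho,\mu_y,\mu_x,\delta>0$, $0<\mu\le L$, $\alpha\in(0,\frac12]$, $\epsilon_0\ge0$ and $0<\epsilon\le\delta^2(d+d')/\min\{\rho,\mu_y\}$ be given. Then there are $\eta_0>0$ and a number $K\ge0$ of epochs, depending only on these numbers, such that the total number of iterations satisfies $$\sum_{k=1}^K T_k\ \le\ C\Big(1+\log\Big(1+\Big(\frac{\rho}{\mu_x}+1\Big)\frac{\epsilon_0}{\epsilon}\Big)\Big)^p\Big(\frac{\rho}{\mu_x}+1\Big)\left(\frac{\delta^2(L+\rho)^2(d+d')}{\mu^2\min\{\rho,\mu_y\}\,\epsilon}\right)^{\frac1{2(1-\alpha)}},$$ and, for every problem, starting point and oracle as above,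 if almost surely $\|\mathcal G_t\|_\infty\le\delta$ at each iteration of the $K$ epochs and $\|g^k_{1:T_k,i}\|_2\le\delta T_k^\alpha$ for all $k\le K$ and all coordinates $i$, then $\mathrm{Gap}(x_K,y_K)$ is integrable and $\mathbb E[\mathrm{Gap}(x_K,y_K)]\le\epsilon$. -/

import Mathlib

open MeasureTheory ProbabilityTheory

noncomputable section

/-- `ℝ^n` with the Euclidean norm. -/
abbrev Vec (n : ℕ) := EuclideanSpace ℝ (Fin n)

/-- `ℝ^(d+d')`, the space of the joint variable `z = (x, y)`, with the Euclidean norm. -/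
abbrev JointVec (d d' : ℕ) := EuclideanSpace ℝ (Fin d ⊕ Fin d')

/-- The vector `(x, y)`. -/
def joinVec {d d' : ℕ} (x : Vec d) (y : Vec d') : JointVec d d' :=
  WithLp.toLp 2 (Sum.elim (fun i => x i) (fun i => y i))

/-- The `x`-block of `z`. -/
def xPart {d d' : ℕ} (z : JointVec d d') : Vec d := WithLp.toLp 2 (fun i => z (Sum.inl i))

/-- The `y`-block of `z`. -/
def yPart {d d' : ℕ} (z : JointVec d d') : Vec d' := WithLp.toLp 2 (fun i => z (Sum.inr i))

/-! ### The min-max problem -/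

/-- Partial gradient `∇ₓ f(x, y)`. -/
def gradX {d d' : ℕ} (f : Vec d → Vec d' → ℝ) (x : Vec d) (y : Vec d') : Vec d :=
  gradient (fun x' => f x' y) x

/-- Partial gradient `∇_y f(x, y)`. -/
def gradY {d d' : ℕ} (f : Vec d → Vec d' → ℝ) (x : Vec d) (y : Vec d') : Vec d' :=
  gradient (fun y' => f x y') y

/-- The primal objective `P(x) = max_{y ∈ Y} f(x, y)`. -/
def primal {d d' : ℕ} (f : Vec d → Vec d' → ℝ) (Y : Set (Vec d')) (x : Vec d) : ℝ :=
  sSup ((fun y' => f x y') '' Y)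

/-- The duality gap `max_{y' ∈ Y} f(x, y') - min_{x'} f(x', y)`. -/
def dualityGap {d d' : ℕ} (f : Vec d → Vec d' → ℝ) (Y : Set (Vec d')) (x : Vec d) (y : Vec d') :
    ℝ :=
  primal f Y x - sInf (Set.range (fun x' => f x' y))

/-- The `μ`-PL condition on `ℝ^n`: `h` has a global minimiser `xs` and
`‖∇h(x)‖² ≥ 2 μ (h(x) - h(xs))` for all `x`. -/
def PLCondition {n : ℕ} (h : Vec n → ℝ) (μ : ℝ) : Prop :=
  Differentiable ℝ h ∧
    ∃ xs, (∀ x, h xs ≤ h x) ∧ ∀ x, 2 * μ * (h x - h xs) ≤ ‖gradient h x‖ ^ 2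

/-- The assumptions on the objective `f`, the constraint set `Y` and the starting point. -/
structure MinMaxAssumptions {d d' : ℕ} (f : Vec d → Vec d' → ℝ) (Y : Set (Vec d'))
    (ℓ L ρ μ μy μx ε₀ : ℝ) (x₀ : Vec d) (y₀ : Vec d') : Prop where
  closed : IsClosed Y
  convex : Convex ℝ Y
  diffX : ∀ x, ∀ y ∈ Y, DifferentiableAt ℝ (fun x' => f x' y) x
  diffY : ∀ x, ∀ y ∈ Y, DifferentiableAt ℝ (fun y' => f x y') y
  /-- `F = (∇ₓ f, -∇_y f)` is `ℓ`-Lipschitz on `ℝ^d × Y`. -/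
  lipschitz : ∀ x x', ∀ y ∈ Y, ∀ y' ∈ Y,
    ‖gradX f x y - gradX f x' y'‖ ^ 2 + ‖gradY f x y - gradY f x' y'‖ ^ 2
      ≤ ℓ ^ 2 * (‖x - x'‖ ^ 2 + ‖y - y'‖ ^ 2)
  /-- `f` is `μy`-strongly concave in `y ∈ Y`. -/
  strongConcave : ∀ x, StrongConcaveOn Y μy (fun y => f x y)
  /-- `P` is `L`-smooth. -/
  primalDiff : Differentiable ℝ (primal f Y)
  primalSmooth : ∀ x x',
    ‖gradient (primal f Y) x - gradient (primal f Y) x'‖ ≤ L * ‖x - x'‖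
  /-- `P` has a minimiser and satisfies the `μ`-PL condition. -/
  primalPL : PLCondition (primal f Y) μ
  /-- The `x`-side `μx`-PL condition. -/
  xSidePL : ∀ y ∈ Y, PLCondition (fun x => f x y) μx
  /-- `f` is `ρ`-weakly convex in `x`, with `ρ ≤ ℓ`. -/
  rho_le : ρ ≤ ℓ
  weakConvex : ∀ x x', ∀ y ∈ Y,
    inner ℝ (gradX f x' y) (x - x') - ρ / 2 * ‖x - x'‖ ^ 2 ≤ f x y - f x' y
  /-- The starting point is feasible and its duality gap is at most `ε₀`. -/
  start_mem : y₀ ∈ Y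
  start_gap : dualityGap f Y x₀ y₀ ≤ ε₀

/-- The stochastic first-order oracle `(Gx, Gy)`, queried with the random variables `ξ k t`
(the one used at the `t`-th iteration of the `k`-th epoch): the `ξ k t` are independent, and each
of them gives an unbiased estimate of the gradient at every point of `ℝ^d × Y`. -/
structure UnbiasedOracle {d d' : ℕ} {Ω Ξ : Type*} [MeasurableSpace Ω] [MeasurableSpace Ξ]
    (f : Vec d → Vec d' → ℝ) (Y : Set (Vec d'))
    (Gx : Vec d → Vec d' → Ξ → Vec d) (Gy : Vec d → Vec d' → Ξ → Vec d')
    (ξ : ℕ → ℕ → Ω → Ξ) (Pr : Measure Ω) : Prop where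
  measX : Measurable (fun q : (Vec d × Vec d') × Ξ => Gx q.1.1 q.1.2 q.2)
  measY : Measurable (fun q : (Vec d × Vec d') × Ξ => Gy q.1.1 q.1.2 q.2)
  measSample : ∀ k t, Measurable (ξ k t)
  indep : iIndepFun (fun i : ℕ × ℕ => ξ i.1 i.2) Pr
  integrableX : ∀ k t x, ∀ y ∈ Y, Integrable (fun ω => Gx x y (ξ k t ω)) Pr
  integrableY : ∀ k t x, ∀ y ∈ Y, Integrable (fun ω => Gy x y (ξ k t ω)) Pr
  unbiasedX : ∀ k t x, ∀ y ∈ Y, ∫ ω, Gx x y (ξ k t ω) ∂Pr = gradX f x y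
  unbiasedY : ∀ k t x, ∀ y ∈ Y, ∫ ω, Gy x y (ξ k t ω) ∂Pr = gradY f x y

/-! ### AdaGrad min-max (inner loop) -/

/-- Stochastic gradient at `z` of the proximal objective `f(x, y) + (γ/2) ‖x - xref‖²`:
`(∇ₓ f(x, y; s) + γ (x - xref), -∇_y f(x, y; s))`. -/
def proxGrad {d d' : ℕ} {Ξ : Type*}
    (Gx : Vec d → Vec d' → Ξ → Vec d) (Gy : Vec d → Vec d' → Ξ → Vec d')
    (γ : ℝ) (xref : Vec d) (z : JointVec d d') (s : Ξ) : JointVec d d' :=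
  joinVec (Gx (xPart z) (yPart z) s + γ • (xPart z - xref)) (-Gy (xPart z) (yPart z) s)

/-- A minimiser of `φ` over `S` (meaningful when there is one). -/
def argminOn {E : Type*} [Nonempty E] (φ : E → ℝ) (S : Set E) : E :=
  Classical.epsilon (fun z => z ∈ S ∧ IsMinOn φ S z)

/-- The state of AdaGrad after `t` gradients: the current point `z_{t+1}`, the sum
`∑_{τ ≤ t} 𝒢_τ`, and the vector of `s_{t,i}² = ‖g_{1:t,i}‖² = ∑_{τ ≤ t} 𝒢_{τ,i}²`. -/
structure AdaState (d d' : ℕ) where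
  point : JointVec d d'
  gradSum : JointVec d d'
  sqSum : Fin d ⊕ Fin d' → ℝ

/-- AdaGrad on `ℝ^d × Y` with stochastic gradient `G`, started at `z_1 = z₀`, with
`H_t = δ I + diag(s_t)`, `ψ_t(z) = ½ ⟨z - z₀, H_t (z - z₀)⟩` and
`z_{t+1} = argmin_{z} η ⟨z, (1/t) ∑_{τ ≤ t} 𝒢_τ⟩ + (1/t) ψ_t(z)`.
The sample used for the gradient at `z_{t+1}` is `s t`. -/
def adaState {d d' : ℕ} {Ξ : Type*} (G : JointVec d d' → Ξ → JointVec d d')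
    (Y : Set (Vec d')) (δ η : ℝ) (z₀ : JointVec d d') (s : ℕ → Ξ) : ℕ → AdaState d d'
  | 0 => ⟨z₀, 0, 0⟩
  | t + 1 =>
    let S := adaState G Y δ η z₀ s t
    let g := G S.point (s t)
    let sum := S.gradSum + g
    let sq : Fin d ⊕ Fin d' → ℝ := fun i => S.sqSum i + g i ^ 2
    ⟨argminOn (fun z => η * inner ℝ z ((1 / ((t : ℝ) + 1)) • sum)
        + (1 / ((t : ℝ) + 1)) * (1 / 2 * ∑ i, (δ + √(sq i)) * (z i - z₀ i) ^ 2))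
        {z | yPart z ∈ Y}, sum, sq⟩

/-- The output `(1/T) ∑_{t=1}^T z_t` of AdaGrad. -/
def adaOutput {d d' : ℕ} {Ξ : Type*} (G : JointVec d d' → Ξ → JointVec d d')
    (Y : Set (Vec d')) (δ η : ℝ) (z₀ : JointVec d d') (s : ℕ → Ξ) (T : ℕ) : JointVec d d' :=
  (1 / (T : ℝ)) • ∑ t ∈ Finset.range T, (adaState G Y δ η z₀ s t).point

/-! ### The proximal epoch method PES-AdaGrad (outer loop); epochs are counted from `0` -/

/-- The iterates `(x_k, y_k)` of PES-AdaGrad with regularisation `γ`, step sizes `η k` and epoch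
lengths `T k`, along the samples `s k t`. Epoch `k` starts at, and is regularised around,
`(x_k, y_k)`, and its averaged output is `(x_{k+1}, y_{k+1})`. -/
def pesAdaGrad {d d' : ℕ} {Ξ : Type*}
    (Gx : Vec d → Vec d' → Ξ → Vec d) (Gy : Vec d → Vec d' → Ξ → Vec d') (Y : Set (Vec d'))
    (δ γ : ℝ) (η : ℕ → ℝ) (T : ℕ → ℕ) (x₀ : Vec d) (y₀ : Vec d') (s : ℕ → ℕ → Ξ) :
    ℕ → JointVec d d'
  | 0 => joinVec x₀ y₀
  | k + 1 =>
    let z := pesAdaGrad Gx Gy Y δ γ η T x₀ y₀ s k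
    adaOutput (proxGrad Gx Gy γ (xPart z)) Y δ (η k) z (s k) (T k)

/-- The AdaGrad state after `t` gradients in epoch `k` of PES-AdaGrad. -/
def pesState {d d' : ℕ} {Ξ : Type*}
    (Gx : Vec d → Vec d' → Ξ → Vec d) (Gy : Vec d → Vec d' → Ξ → Vec d') (Y : Set (Vec d'))
    (δ γ : ℝ) (η : ℕ → ℝ) (T : ℕ → ℕ) (x₀ : Vec d) (y₀ : Vec d') (s : ℕ → ℕ → Ξ)
    (k t : ℕ) : AdaState d d' :=
  let z := pesAdaGrad Gx Gy Y δ γ η T x₀ y₀ s k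
  adaState (proxGrad Gx Gy γ (xPart z)) Y δ (η k) z (s k) t

/-- The `(t+1)`-st stochastic gradient in epoch `k` of PES-AdaGrad. -/
def pesGrad {d d' : ℕ} {Ξ : Type*}
    (Gx : Vec d → Vec d' → Ξ → Vec d) (Gy : Vec d → Vec d' → Ξ → Vec d') (Y : Set (Vec d'))
    (δ γ : ℝ) (η : ℕ → ℝ) (T : ℕ → ℕ) (x₀ : Vec d) (y₀ : Vec d') (s : ℕ → ℕ → Ξ)
    (k t : ℕ) : JointVec d d' :=
  proxGrad Gx Gy γ (xPart (pesAdaGrad Gx Gy Y δ γ η T x₀ y₀ s k))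
    (pesState Gx Gy Y δ γ η T x₀ y₀ s k t).point (s k t)

/-- The gradients met in the first `K` epochs are almost surely bounded by `δ` in sup norm, and in
each of these epochs the cumulative gradients satisfy `‖g_{1:T_k,i}‖₂ ≤ δ T_k^α` for every
coordinate `i`. -/
structure GradientGrowth {d d' : ℕ} {Ω Ξ : Type*} [MeasurableSpace Ω]
    (Gx : Vec d → Vec d' → Ξ → Vec d) (Gy : Vec d → Vec d' → Ξ → Vec d') (Y : Set (Vec d'))
    (δ γ α : ℝ) (η : ℕ → ℝ) (T : ℕ → ℕ) (x₀ : Vec d) (y₀ : Vec d')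
    (ξ : ℕ → ℕ → Ω → Ξ) (Pr : Measure Ω) (K : ℕ) : Prop where
  bounded : ∀ k < K, ∀ t < T k, ∀ᵐ ω ∂Pr, ∀ i,
    |pesGrad Gx Gy Y δ γ η T x₀ y₀ (fun k t => ξ k t ω) k t i| ≤ δ
  growth : ∀ k < K, ∀ᵐ ω ∂Pr, ∀ i,
    √((pesState Gx Gy Y δ γ η T x₀ y₀ (fun k t => ξ k t ω) k (T k)).sqSum i) ≤ δ * (T k : ℝ) ^ α

/-! ### The schedule -/

/-- Geometrically decreasing step sizes
`η_k = η₀ exp(-(k/2) · 2μ/(c+2μ))`, `c = 4ρ + (248/53)(L + 2ρ)`. -/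
def stepSize (L ρ μ η₀ : ℝ) (k : ℕ) : ℝ :=
  η₀ * Real.exp (-((k : ℝ) / 2) *
    (2 * μ / ((4 * ρ + 248 / 53 * (L + 2 * ρ)) + 2 * μ)))

/-- Epoch lengths `T_k = ⌈(A δ / (η_k min{ρ, μy}))^{1/(1-α)}⌉`. -/
def epochLength (A L ρ μ μy δ α η₀ : ℝ) (k : ℕ) : ℕ :=
  ⌈(A * δ / (stepSize L ρ μ η₀ k * min ρ μy)) ^ (1 / (1 - α))⌉₊

end

noncomputable section

/-! Each epoch is an inexact proximal-point step. The problem `f(x, y) + ρ‖x - xc‖²` is `ρ`-strongly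
convex in `x` and `μy`-strongly concave in `y`; its saddle point `(xs, ys)` has as `xs` a proximal
point of `P` (`exists_saddle`). Put `ν = max μ μx`. `P` is `ν`-PL, because its gradient is that of
`f(·, y)` at a best response `y` (`primal_PL_max`). Since `∇P(xs) = 2ρ(xc - xs)`, PL bounds `P(xs) -
min P` by a multiple of `u = ρ‖xs - xc‖²`, while `P` drops by at least `3u/2` from `xc` to `xs`.
Adding a small multiple of the proximal gap gives a potential that also sees how far the centre is
from the saddle point; `potential_step` contracts it by the factor `1 - proxRate ρ ν`, up to an
additive error.

The inner loop has to bound the proximal gap, for all comparators at once, by a small multiple of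
`min ρ μy` times the squared distance to the centre, plus an error of small mean. This is the regret
bound of dual averaging: the epoch length makes `H_T` at most `ηT · min ρ μy / 20000`. The
comparator may depend on the samples, so the noise paired with it is not centred; Young's inequality
absorbs it into a second copy of the `H_T`-quadratic and leaves the square of the summed noise
divided by `H_T`. `martingale_sq_div_le` bounds the mean of that by the mean of the AdaGrad sum `∑
g²/h`.

The squared step sizes decay at a rate `q` slower than the contraction of the potential, with a
margin of order `1/χe`, `χe = ρ/ν + 1`. So the mean potential is at most `exp(-qk)(2ε₀ + χe η₀² V)`
with `V = (d + d') min ρ μy` (`potential_recursion`), and passing to the duality gap costs a factor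
of order `χ = ρ/μx + 1`. Accuracy `ε` therefore needs a final squared step of order `ε/(χ χe V)`.
The epoch lengths are dominated by a geometric sum, which gives `κ (χ χe Q)^b` iterations up to
constants and the number of epochs, where `κ = (L + ρ)/μ`, `b = 1/(2(1-α))` and `Q = δ²(d + d')/(min
ρ μy · ε)`. As `χe` is at most both `χ` and `κ`, this is at most `χ (κ² Q)^b` (`rpow_condition_le`);
this is where PL with constant `ν`, not just `μ`, matters. -/

lemma le_of_forall_one_sub_mul_le {a b : ℝ}
    (h : ∀ t : ℝ, 0 < t → t < 1 → (1 - t) * b ≤ a) : b ≤ a := by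
  have h1 : Filter.Tendsto (fun t : ℝ => (1 - t) * b) (nhdsWithin 0 (Set.Ioi 0)) (nhds b) := by
    have : Filter.Tendsto (fun t : ℝ => (1 - t) * b) (nhds 0) (nhds ((1 - 0) * b)) :=
      Continuous.tendsto (by fun_prop) 0
    simpa using this.mono_left nhdsWithin_le_nhds
  refine le_of_tendsto h1 ?_
  filter_upwards [Ioo_mem_nhdsGT (zero_lt_one' ℝ)] with t ht using h t ht.1 ht.2

lemma sInf_range_eq_of_forall_le {E : Type*} {φ : E → ℝ} {x : E} (h : ∀ x', φ x ≤ φ x') :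
    sInf (Set.range φ) = φ x :=
  IsLeast.csInf_eq ⟨⟨x, rfl⟩, by rintro _ ⟨x', rfl⟩; exact h x'⟩

/-! ### First-order conditions and proximal points -/

/-- First-order characterisation of strong concavity. -/
lemma StrongConcaveOn.le_add_inner_gradient {n : ℕ} {Y : Set (Vec n)} {m : ℝ} {g : Vec n → ℝ}
    (hg : StrongConcaveOn Y m g) {y y' : Vec n} (hy : y ∈ Y) (hy' : y' ∈ Y)
    (hd : DifferentiableAt ℝ g y) :
    g y' ≤ g y + inner ℝ (gradient g y) (y' - y) - m / 2 * ‖y' - y‖ ^ 2 := by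
  have hline : HasDerivAt (fun t : ℝ => y + t • (y' - y)) (y' - y) 0 := by
    simpa using ((hasDerivAt_id (0 : ℝ)).smul_const (y' - y)).const_add y
  have hgrad : HasFDerivAt g (InnerProductSpace.toDual ℝ _ (gradient g y))
      (y + (0 : ℝ) • (y' - y)) := by
    simpa using hd.hasGradientAt.hasFDerivAt
  have hφ := hgrad.comp_hasDerivAt (0 : ℝ) hline
  simp only [InnerProductSpace.toDual_apply_apply] at hφ
  have hs := hφ.tendsto_slope_zero_right
  have hlim : Filter.Tendsto (fun t : ℝ => g y' - g y + (1 - t) * (m / 2 * ‖y - y'‖ ^ 2))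
      (nhdsWithin 0 (Set.Ioi 0)) (nhds (g y' - g y + (1 - 0) * (m / 2 * ‖y - y'‖ ^ 2))) :=
    (Continuous.tendsto (by fun_prop) 0).mono_left nhdsWithin_le_nhds
  have key := le_of_tendsto_of_tendsto hlim hs (by
    filter_upwards [Ioo_mem_nhdsGT (zero_lt_one' ℝ)] with t ht
    have h2 := hg.2 hy hy' (sub_nonneg.2 ht.2.le) ht.1.le (by ring)
    have e : (1 - t) • y + t • y' = y + t • (y' - y) := by module
    rw [e] at h2
    simp only [smul_eq_mul, Function.comp, zero_add, zero_smul, add_zero] at h2 ⊢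
    rw [← div_eq_inv_mul, le_div_iff₀ ht.1]
    nlinarith [h2])
  rw [norm_sub_rev y y'] at key
  linarith

/-- Existence of, and stationarity at, proximal points of a function that is bounded below. -/
lemma exists_prox {n : ℕ} {h : Vec n → ℝ} (hd : Differentiable ℝ h) {B ρ : ℝ} (hρ : 0 < ρ)
    (hB : ∀ x, B ≤ h x) (x₀ : Vec n) :
    ∃ xh, (∀ x, h xh + ρ * ‖xh - x₀‖ ^ 2 ≤ h x + ρ * ‖x - x₀‖ ^ 2) ∧
      gradient h xh = (2 * ρ) • (x₀ - xh) := by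
  have hc : Continuous fun x => h x + ρ * ‖x - x₀‖ ^ 2 := by
    have := hd.continuous
    fun_prop
  obtain ⟨xh, hxh⟩ := hc.exists_forall_le' x₀ (by
    -- The `+ 1` forces `‖x - x₀‖ ≥ 1` outside the ball, so the squared distance dominates the
    -- distance and the objective exceeds its value at `x₀`.
    have := (isCompact_closedBall x₀ ((h x₀ - B) / ρ + 1)).compl_mem_cocompact
    filter_upwards [this] with x hx
    simp only [Set.mem_compl_iff, Metric.mem_closedBall, not_le, dist_eq_norm] at hx
    have h0 : 0 ≤ (h x₀ - B) / ρ := div_nonneg (by linarith [hB x₀]) hρ.le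
    have h1 : h x₀ - B ≤ ρ * ‖x - x₀‖ := by
      have : (h x₀ - B) / ρ ≤ ‖x - x₀‖ := by linarith
      rw [div_le_iff₀ hρ] at this
      linarith
    have h2 : ρ * ‖x - x₀‖ ≤ ρ * ‖x - x₀‖ ^ 2 := by
      apply mul_le_mul_of_nonneg_left _ hρ.le
      nlinarith
    simp only [sub_self, norm_zero]
    nlinarith [hB x])
  refine ⟨xh, hxh, ?_⟩
  have h1 : HasFDerivAt (fun x => h x + ρ * ‖x - x₀‖ ^ 2)
      (fderiv ℝ h xh + ρ • (2 • (innerSL ℝ (xh - x₀)))) xh := by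
    have h3 : HasFDerivAt (fun x : Vec n => x - x₀) (ContinuousLinearMap.id ℝ _) xh :=
      (hasFDerivAt_id xh).sub_const x₀
    have h4 := h3.norm_sq.const_mul ρ
    exact (hd xh).hasFDerivAt.add h4
  have h2 : fderiv ℝ h xh + ρ • (2 • (innerSL ℝ (xh - x₀))) = 0 :=
    IsLocalMin.hasFDerivAt_eq_zero (Filter.Eventually.of_forall fun x => hxh x) h1
  apply ext_inner_right ℝ
  intro v
  have h5 := congrArg (fun T => T v) h2
  have h6 : inner ℝ (gradient h xh) v = fderiv ℝ h xh v := by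
    simp [gradient]
  rw [h6]
  simp only [add_apply, smul_apply, innerSL_apply_apply,
    zero_apply, smul_eq_mul, nsmul_eq_mul] at h5
  rw [inner_smul_left, ← neg_sub xh x₀, inner_neg_left]
  simp at h5 ⊢
  linarith

lemma norm_sub_sq_le_two_mul {n : ℕ} (a b c : Vec n) :
    ‖a - c‖ ^ 2 ≤ 2 * ‖a - b‖ ^ 2 + 2 * ‖b - c‖ ^ 2 := by
  have h1 : ‖a - c‖ ≤ ‖a - b‖ + ‖b - c‖ := norm_sub_le_norm_sub_add_norm_sub a b c
  nlinarith [norm_nonneg (a - c), sq_nonneg (‖a - b‖ - ‖b - c‖)]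

/-- With `p = x₁ - xh`, `q = xh - xb`, `r = xb - xc` the left side is `2⟨p + q, r⟩ - ‖p‖²/2`, and
the bound is `‖p - 2r‖² ≥ 0` plus `‖q - r‖² ≥ 0`. It is the price of moving the proximal centre from
`xc` to `xb`. -/
lemma norm_sub_sq_recentre {n : ℕ} (x₁ xh xb xc : Vec n) :
    ‖x₁ - xc‖ ^ 2 - ‖x₁ - xb‖ ^ 2 - ‖xb - xc‖ ^ 2 - 1 / 2 * ‖x₁ - xh‖ ^ 2 ≤
      ‖xb - xh‖ ^ 2 + 3 * ‖xb - xc‖ ^ 2 := by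
  obtain ⟨p, rfl⟩ : ∃ p, x₁ = p + xh := ⟨x₁ - xh, by simp⟩
  obtain ⟨q, rfl⟩ : ∃ q, xh = q + xb := ⟨xh - xb, by simp⟩
  obtain ⟨r, rfl⟩ : ∃ r, xb = r + xc := ⟨xb - xc, by simp⟩
  have e1 : p + (q + (r + xc)) - xc = (p + q) + r := by module
  have e2 : p + (q + (r + xc)) - (r + xc) = p + q := by module
  have e3 : r + xc - (q + (r + xc)) = -q := by module
  rw [e1, e2, e3, add_sub_cancel_right, add_sub_cancel_right, norm_neg, norm_add_sq_real,
    inner_add_left]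
  have h1 : 0 ≤ ‖p - (2 : ℝ) • r‖ ^ 2 := by positivity
  have h2 : 0 ≤ ‖q - r‖ ^ 2 := by positivity
  rw [norm_sub_sq_real, norm_smul, inner_smul_right, mul_pow] at h1
  rw [norm_sub_sq_real] at h2
  norm_num at h1
  linarith

/-! ### The primal function, its PL constant and the proximal saddle point -/

namespace MinMaxAssumptions

variable {d d' : ℕ} {f : Vec d → Vec d' → ℝ} {Y : Set (Vec d')} {ℓ L ρ μ μy μx ε₀ : ℝ}
  {x₀ : Vec d} {y₀ : Vec d'}

lemma continuousOn_y (hA : MinMaxAssumptions f Y ℓ L ρ μ μy μx ε₀ x₀ y₀) (x : Vec d) :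
    ContinuousOn (fun y => f x y) Y :=
  fun y hy => (hA.diffY x y hy).continuousAt.continuousWithinAt

lemma exists_max (hA : MinMaxAssumptions f Y ℓ L ρ μ μy μx ε₀ x₀ y₀) (hμy : 0 < μy) (x : Vec d) :
    ∃ y ∈ Y, primal f Y x = f x y ∧ ∀ y' ∈ Y, f x y' + μy / 2 * ‖y' - y‖ ^ 2 ≤ f x y := by
  obtain ⟨y, hy, hmax⟩ := (hA.continuousOn_y x).exists_isMaxOn' hA.closed hA.start_mem (by
    have := (isCompact_closedBall y₀
      (2 * ‖gradient (fun y => f x y) y₀‖ / μy)).compl_mem_cocompact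
    rw [Filter.eventually_inf_principal]
    filter_upwards [this] with y hy hyY
    simp only [Set.mem_compl_iff, Metric.mem_closedBall, not_le, dist_eq_norm] at hy
    rw [div_lt_iff₀ hμy] at hy
    have h1 := (hA.strongConcave x).le_add_inner_gradient hA.start_mem hyY
      (hA.diffY x y₀ hA.start_mem)
    have h2 := real_inner_le_norm (gradient (fun y => f x y) y₀) (y - y₀)
    have h3 := norm_nonneg (y - y₀)
    nlinarith)
  refine ⟨y, hy, ?_, fun y' hy' => ?_⟩
  · exact IsGreatest.csSup_eq ⟨⟨y, hy, rfl⟩, by rintro _ ⟨y', hy', rfl⟩; exact hmax hy'⟩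
  · have : μy / 2 * ‖y' - y‖ ^ 2 ≤ f x y - f x y' := by
      -- Compare with the point at parameter `t` on the segment to `y'`, divide by `t`, and let `t`
      -- tend to zero.
      refine le_of_forall_one_sub_mul_le fun t h0 h1 => ?_
      have h2 := (hA.strongConcave x).2 hy hy' (sub_nonneg.2 h1.le) h0.le (by ring)
      have h3 : f x ((1 - t) • y + t • y') ≤ f x y :=
        hmax (hA.convex hy hy' (sub_nonneg.2 h1.le) h0.le (by ring))
      rw [norm_sub_rev y y'] at h2
      simp only [smul_eq_mul] at h2
      have h4 : t * ((1 - t) * (μy / 2 * ‖y' - y‖ ^ 2)) ≤ t * (f x y - f x y') := by linarith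
      exact le_of_mul_le_mul_left h4 h0
    linarith

lemma le_primal (hA : MinMaxAssumptions f Y ℓ L ρ μ μy μx ε₀ x₀ y₀) (hμy : 0 < μy) (x : Vec d)
    {y : Vec d'} (hy : y ∈ Y) : f x y ≤ primal f Y x := by
  obtain ⟨yh, -, h1, h2⟩ := hA.exists_max hμy x
  rw [h1]
  have : 0 ≤ μy / 2 * ‖y - yh‖ ^ 2 := by positivity
  linarith [h2 y hy]

/-- Danskin's formula: `P` is assumed differentiable, so it suffices that `P - f(·, y)` is
nonnegative and vanishes at `x`. -/
lemma gradient_primal (hA : MinMaxAssumptions f Y ℓ L ρ μ μy μx ε₀ x₀ y₀) (hμy : 0 < μy)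
    {x : Vec d} {y : Vec d'} (hy : y ∈ Y) (h : primal f Y x = f x y) :
    gradient (primal f Y) x = gradX f x y := by
  have h1 : IsLocalMin (fun x' => primal f Y x' - f x' y) x :=
    Filter.Eventually.of_forall fun x' => by
      simpa [h] using hA.le_primal hμy x' hy
  have h2 := h1.hasFDerivAt_eq_zero
    ((hA.primalDiff x).hasFDerivAt.sub (hA.diffX x y hy).hasFDerivAt)
  simp only [gradX, gradient]
  rw [sub_eq_zero.1 h2]

lemma primal_ge (hA : MinMaxAssumptions f Y ℓ L ρ μ μy μx ε₀ x₀ y₀) {x : Vec d} :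
    sInf (Set.range (primal f Y)) ≤ primal f Y x := by
  obtain ⟨-, xs, hxs, -⟩ := hA.primalPL
  rw [sInf_range_eq_of_forall_le hxs]
  exact hxs x

lemma sInf_le_primal (hA : MinMaxAssumptions f Y ℓ L ρ μ μy μx ε₀ x₀ y₀) (hμy : 0 < μy)
    {y : Vec d'} (hy : y ∈ Y) :
    sInf (Set.range fun x => f x y) ≤ sInf (Set.range (primal f Y)) := by
  obtain ⟨-, xs, hxs, -⟩ := hA.primalPL
  obtain ⟨-, xt, hxt, -⟩ := hA.xSidePL y hy
  rw [sInf_range_eq_of_forall_le hxs, sInf_range_eq_of_forall_le hxt]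
  exact (hxt xs).trans (hA.le_primal hμy xs hy)

/-- The primal function is `max μ μx`-PL. -/
lemma primal_PL_max (hA : MinMaxAssumptions f Y ℓ L ρ μ μy μx ε₀ x₀ y₀) (hμy : 0 < μy)
    (hμx : 0 < μx) (x : Vec d) :
    2 * max μ μx * (primal f Y x - sInf (Set.range (primal f Y))) ≤
      ‖gradient (primal f Y) x‖ ^ 2 := by
  rcases max_choice μ μx with h | h <;> rw [h]
  · obtain ⟨-, xs, hxs, hPL⟩ := hA.primalPL
    rw [sInf_range_eq_of_forall_le hxs]
    exact hPL x
  -- At a best response `y` the values and gradients of `P` and `f(·, y)` agree at `x`, while `min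
  -- f(·, y) ≤ min P`; so PL of `f(·, y)` passes to `P`.
  · obtain ⟨y, hy, h1, -⟩ := hA.exists_max hμy x
    have h2 := hA.sInf_le_primal hμy hy
    obtain ⟨-, xt, hxt, hPL⟩ := hA.xSidePL y hy
    rw [hA.gradient_primal hμy hy h1]
    rw [sInf_range_eq_of_forall_le hxt] at h2
    refine le_trans ?_ (hPL x)
    gcongr
    exact h1.le

/-- The hypothesis says that `xh` is stationary for the proximal objective, which is `ρ`-strongly
convex: the regulariser contributes `2ρ` and weak convexity takes away `ρ`. -/
lemma growth_of_gradX (hA : MinMaxAssumptions f Y ℓ L ρ μ μy μx ε₀ x₀ y₀)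
    {y : Vec d'} (hy : y ∈ Y) {xc xh : Vec d} (hg : gradX f xh y = (2 * ρ) • (xc - xh))
    (x : Vec d) :
    f xh y + ρ * ‖xh - xc‖ ^ 2 + ρ / 2 * ‖x - xh‖ ^ 2 ≤ f x y + ρ * ‖x - xc‖ ^ 2 := by
  have h1 := hA.weakConvex x xh y hy
  rw [hg, inner_smul_left, ← neg_sub xh xc, inner_neg_left, real_inner_comm] at h1
  have h2 : ‖x - xc‖ ^ 2 = ‖x - xh‖ ^ 2 + 2 * inner ℝ (x - xh) (xh - xc) + ‖xh - xc‖ ^ 2 := by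
    rw [← norm_add_sq_real, sub_add_sub_cancel]
  rw [h2]
  simp at h1
  linarith

/-- Proximal points of `f(·, y)` exist and satisfy a quadratic growth condition. -/
lemma exists_prox_x (hA : MinMaxAssumptions f Y ℓ L ρ μ μy μx ε₀ x₀ y₀) (hρ : 0 < ρ)
    {y : Vec d'} (hy : y ∈ Y) (xc : Vec d) :
    ∃ xh, gradX f xh y = (2 * ρ) • (xc - xh) ∧
      ∀ x, f xh y + ρ * ‖xh - xc‖ ^ 2 + ρ / 2 * ‖x - xh‖ ^ 2 ≤ f x y + ρ * ‖x - xc‖ ^ 2 := by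
  obtain ⟨hd, xt, hxt, -⟩ := hA.xSidePL y hy
  obtain ⟨xh, -, hg⟩ := exists_prox hd hρ hxt xc
  exact ⟨xh, hg, hA.growth_of_gradX hy hg⟩

/-- The proximal problem has a saddle point, whose `x`-part is a proximal point of `P`. -/
lemma exists_saddle (hA : MinMaxAssumptions f Y ℓ L ρ μ μy μx ε₀ x₀ y₀) (hρ : 0 < ρ)
    (hμy : 0 < μy) (xc : Vec d) :
    ∃ xs, ∃ ys ∈ Y, gradient (primal f Y) xs = (2 * ρ) • (xc - xs) ∧
      gradX f xs ys = (2 * ρ) • (xc - xs) ∧ primal f Y xs = f xs ys ∧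
      ∀ y' ∈ Y, f xs y' + μy / 2 * ‖y' - ys‖ ^ 2 ≤ f xs ys := by
  obtain ⟨hd, xt, hxt, -⟩ := hA.primalPL
  obtain ⟨xs, -, hg⟩ := exists_prox hd hρ hxt xc
  obtain ⟨ys, hys, h1, h2⟩ := hA.exists_max hμy xs
  exact ⟨xs, ys, hys, hg, (hA.gradient_primal hμy hys h1) ▸ hg, h1, h2⟩

end MinMaxAssumptions

/-! ### The potential and its contraction under an inexact proximal step -/

/-- The duality gap of the proximal problem centred at `x`, at the point `(x, y)`. -/
def proxGap {d d' : ℕ} (f : Vec d → Vec d' → ℝ) (Y : Set (Vec d')) (ρ : ℝ) (x : Vec d)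
    (y : Vec d') : ℝ :=
  primal f Y x - sInf (Set.range fun x' => f x' y + ρ * ‖x' - x‖ ^ 2)

/-- The potential `P(x) - min P + proxGap(x, y) / 600`. -/
def potential {d d' : ℕ} (f : Vec d → Vec d' → ℝ) (Y : Set (Vec d')) (ρ : ℝ) (x : Vec d)
    (y : Vec d') : ℝ :=
  primal f Y x - sInf (Set.range (primal f Y)) + 1 / 600 * proxGap f Y ρ x y

/-- The contraction rate `0.49 ν / (2 ρ + 1.5 ν)` of the potential for a `ν`-PL primal function. -/
def proxRate (ρ ν : ℝ) : ℝ := 49 / 100 * ν / (2 * ρ + 3 / 2 * ν)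

/-- Scalar form of the contraction: `p₀`, `b`, `p₁` are the primal gaps at the centre, at its
proximal point and at the inexact proximal point. -/
lemma proxRate_contraction {ρ ν p₀ p₁ b u g Γ₀ Γ₁ R : ℝ} (hρ : 0 < ρ) (hν : 0 < ν)
    (hb : 0 ≤ b) (hΓ₀ : 0 ≤ Γ₀) (hg : 0 ≤ g) (hu : ν * b ≤ 2 * ρ * u)
    (hp₀ : b + 3 / 2 * u ≤ p₀) (hp₁ : p₁ ≤ b + u + g) (hΓ₁ : Γ₁ ≤ 15 * g + 6 * u)
    (hgR : g ≤ 1 / 20000 * (8 * (g + Γ₀)) + R) :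
    p₁ + 1 / 600 * Γ₁ ≤ (1 - proxRate ρ ν) * (p₀ + 1 / 600 * Γ₀) + 41 / 20 * R := by
  have hθ : proxRate ρ ν * (2 * ρ + 3 / 2 * ν) = 49 / 100 * ν := by
    rw [proxRate, div_mul_cancel₀]
    positivity
  have hθ0 : 0 ≤ proxRate ρ ν := by
    rw [proxRate]
    positivity
  generalize proxRate ρ ν = θ at *
  have hθ1 : θ ≤ 1 / 2 := by nlinarith
  have hu0 : 0 ≤ u := by
    have : 0 ≤ 2 * ρ * u := (mul_nonneg hν.le hb).trans hu
    exact nonneg_of_mul_nonneg_right this (by positivity)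
  -- PL gives `b ≤ 2ρu/ν`, and `proxRate` is the value of `θ` for which this is exact. The number
  -- `49/100` is the spare decrease `3/2 - (1 + 6/600)` in `u`.
  have key : θ * (b + 3 / 2 * u) ≤ 49 / 100 * u := by
    have : ν * (θ * (b + 3 / 2 * u)) ≤ ν * (49 / 100 * u) := by
      calc ν * (θ * (b + 3 / 2 * u))
          = θ * (ν * b) + θ * (3 / 2 * ν * u) := by ring
        _ ≤ θ * (2 * ρ * u) + θ * (3 / 2 * ν * u) := by gcongr
        _ = (θ * (2 * ρ + 3 / 2 * ν)) * u := by ring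
        _ = ν * (49 / 100 * u) := by rw [hθ]; ring
    exact le_of_mul_le_mul_left this hν
  -- The total weight of `g` is `1 + 15/600 = 41/40`. Doubled, it gives the coefficient `41/20` of
  -- `R` and a multiple of `Γ₀` below `1/1200`, hence below `(1 - θ)/600`.
  have k2 : g ≤ 2 * (8 / 20000 * Γ₀ + R) := by linarith
  have k3 := mul_le_mul_of_nonneg_right hθ1 hΓ₀
  have k4 : (1 - θ) * (b + 3 / 2 * u) ≤ (1 - θ) * p₀ :=
    mul_le_mul_of_nonneg_left hp₀ (by linarith)
  linarith

namespace MinMaxAssumptions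

variable {d d' : ℕ} {f : Vec d → Vec d' → ℝ} {Y : Set (Vec d')} {ℓ L ρ μ μy μx ε₀ : ℝ}
  {x₀ : Vec d} {y₀ : Vec d'}

lemma proxGap_eq {y : Vec d'} {x xh : Vec d} (hρ : 0 < ρ)
    (h : ∀ x', f xh y + ρ * ‖xh - x‖ ^ 2 + ρ / 2 * ‖x' - xh‖ ^ 2 ≤ f x' y + ρ * ‖x' - x‖ ^ 2) :
    proxGap f Y ρ x y = primal f Y x - (f xh y + ρ * ‖xh - x‖ ^ 2) := by
  rw [proxGap, sInf_range_eq_of_forall_le (x := xh)]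
  intro x'
  have : 0 ≤ ρ / 2 * ‖x' - xh‖ ^ 2 := by positivity
  linarith [h x']

lemma proxGap_nonneg (hA : MinMaxAssumptions f Y ℓ L ρ μ μy μx ε₀ x₀ y₀) (hρ : 0 < ρ)
    (hμy : 0 < μy) (x : Vec d) {y : Vec d'} (hy : y ∈ Y) : 0 ≤ proxGap f Y ρ x y := by
  obtain ⟨xh, -, h⟩ := hA.exists_prox_x hρ hy x
  rw [proxGap_eq hρ h]
  have h1 := h x
  have h2 := hA.le_primal hμy x hy
  have h3 : 0 ≤ ρ / 2 * ‖x - xh‖ ^ 2 := by positivity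
  simp at h1
  linarith

lemma proxGap_le_dualityGap (hA : MinMaxAssumptions f Y ℓ L ρ μ μy μx ε₀ x₀ y₀) (hρ : 0 < ρ)
    (x : Vec d) {y : Vec d'} (hy : y ∈ Y) : proxGap f Y ρ x y ≤ dualityGap f Y x y := by
  obtain ⟨xh, -, h⟩ := hA.exists_prox_x hρ hy x
  obtain ⟨-, xt, hxt, -⟩ := hA.xSidePL y hy
  rw [proxGap_eq hρ h, dualityGap, sInf_range_eq_of_forall_le hxt]
  have : 0 ≤ ρ * ‖xh - x‖ ^ 2 := by positivity
  linarith [hxt xh]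

lemma dualityGap_nonneg (hA : MinMaxAssumptions f Y ℓ L ρ μ μy μx ε₀ x₀ y₀)
    (hμy : 0 < μy) (x : Vec d) {y : Vec d'} (hy : y ∈ Y) : 0 ≤ dualityGap f Y x y := by
  obtain ⟨-, xt, hxt, -⟩ := hA.xSidePL y hy
  rw [dualityGap, sInf_range_eq_of_forall_le hxt]
  linarith [hxt x, hA.le_primal hμy x hy]

/-- At the proximal point `xh` of `f(·, y)` the gradient is `2ρ(x - xh)`, and the proximal gap
bounds `ρ‖x - xh‖²/2`. The `μx`-PL inequality at `xh` then bounds how far `f(xh, y)` lies above `min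
f(·, y)`. -/
lemma dualityGap_le_proxGap (hA : MinMaxAssumptions f Y ℓ L ρ μ μy μx ε₀ x₀ y₀) (hρ : 0 < ρ)
    (hμy : 0 < μy) (hμx : 0 < μx) (x : Vec d) {y : Vec d'} (hy : y ∈ Y) :
    dualityGap f Y x y ≤ 4 * (ρ / μx + 1) * proxGap f Y ρ x y := by
  obtain ⟨xh, hg, h⟩ := hA.exists_prox_x hρ hy x
  obtain ⟨-, xt, hxt, hPL⟩ := hA.xSidePL y hy
  rw [proxGap_eq hρ h, dualityGap, sInf_range_eq_of_forall_le hxt]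
  have h1 := h x
  have h2 := hA.le_primal hμy x hy
  have h3 := hPL xh
  have hg' : gradient (fun x => f x y) xh = (2 * ρ) • (x - xh) := hg
  rw [hg', norm_smul, Real.norm_of_nonneg (by positivity), norm_sub_rev x xh] at h3
  rw [norm_sub_rev x xh] at h1
  simp only [sub_self, norm_zero] at h1
  set G := primal f Y x - (f xh y + ρ * ‖xh - x‖ ^ 2) with hG
  have h5 : ρ * ‖xh - x‖ ^ 2 ≤ 2 * G := by linarith
  have h6 : f xh y - f xt y ≤ 4 * (ρ / μx) * G := by
    have : 2 * μx * (f xh y - f xt y) ≤ 2 * μx * (4 * (ρ / μx) * G) := by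
      have e : 2 * μx * (4 * (ρ / μx) * G) = 8 * ρ * G := by field_simp; ring
      rw [e]
      nlinarith
    exact le_of_mul_le_mul_left this (by positivity)
  have h7 : 0 ≤ G := by
    have : 0 ≤ ρ * ‖xh - x‖ ^ 2 := by positivity
    linarith
  linarith

lemma dualityGap_le_potential (hA : MinMaxAssumptions f Y ℓ L ρ μ μy μx ε₀ x₀ y₀) (hρ : 0 < ρ)
    (hμy : 0 < μy) (hμx : 0 < μx) (x : Vec d) {y : Vec d'} (hy : y ∈ Y) :
    dualityGap f Y x y ≤ 2400 * (ρ / μx + 1) * potential f Y ρ x y := by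
  have h1 := hA.dualityGap_le_proxGap hρ hμy hμx x hy
  have h2 : proxGap f Y ρ x y ≤ 600 * potential f Y ρ x y := by
    have h2 := hA.primal_ge (x := x)
    rw [potential]
    linarith
  have h3 : 0 ≤ 4 * (ρ / μx + 1) := by positivity
  nlinarith

lemma potential_start_le (hA : MinMaxAssumptions f Y ℓ L ρ μ μy μx ε₀ x₀ y₀) (hρ : 0 < ρ)
    (hμy : 0 < μy) (hε₀ : 0 ≤ ε₀) : potential f Y ρ x₀ y₀ ≤ 2 * ε₀ := by
  have h1 := hA.proxGap_le_dualityGap hρ x₀ hA.start_mem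
  have h2 := hA.sInf_le_primal hμy hA.start_mem
  have h3 := hA.start_gap
  have h4 : primal f Y x₀ - sInf (Set.range (primal f Y)) ≤ ε₀ := by
    rw [dualityGap] at h3
    linarith
  rw [potential]
  linarith

/-- One inexact proximal step contracts the potential. -/
theorem potential_step (hA : MinMaxAssumptions f Y ℓ L ρ μ μy μx ε₀ x₀ y₀) (hρ : 0 < ρ)
    (hμ : 0 < μ) (hμy : 0 < μy) (hμx : 0 < μx) {xc xb : Vec d} {yc yb : Vec d'} (hyc : yc ∈ Y)
    (hyb : yb ∈ Y) {R : ℝ}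
    (h : ∀ x, ∀ y ∈ Y, f xb y + ρ * ‖xb - xc‖ ^ 2 - (f x yb + ρ * ‖x - xc‖ ^ 2) ≤
      1 / 20000 * (min ρ μy * (‖x - xc‖ ^ 2 + ‖y - yc‖ ^ 2)) + R) :
    potential f Y ρ xb yb ≤
      (1 - proxRate ρ (max μ μx)) * potential f Y ρ xc yc + 41 / 20 * R := by
  obtain ⟨xs, ys, hys, hgs, hgs', hPs, hmax⟩ := hA.exists_saddle hρ hμy xc
  have hsad := hA.growth_of_gradX hys hgs'
  obtain ⟨xh, -, hxh⟩ := hA.exists_prox_x hρ hyb xc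
  obtain ⟨yh, hyh, hPh, hmaxh⟩ := hA.exists_max hμy xb
  obtain ⟨x0, -, hx0⟩ := hA.exists_prox_x hρ hyc xc
  obtain ⟨x1, -, hx1⟩ := hA.exists_prox_x hρ hyb xb
  have posρ : ∀ v : Vec d, 0 ≤ ρ / 2 * ‖v‖ ^ 2 := fun v => by positivity
  have posμ : ∀ v : Vec d', 0 ≤ μy / 2 * ‖v‖ ^ 2 := fun v => by positivity
  have hcc : ρ * ‖xc - xc‖ ^ 2 = 0 := by simp
  -- This is the proximal gap of the output, attained at the best responses `xh` and `yh`; only for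
  -- these two points is the hypothesis `h` needed.
  obtain ⟨g, hg⟩ : ∃ g, g = f xb yh + ρ * ‖xb - xc‖ ^ 2 - (f xh yb + ρ * ‖xh - xc‖ ^ 2) :=
    ⟨_, rfl⟩
  have e0 : g ≤ 1 / 20000 * (min ρ μy * (‖xh - xc‖ ^ 2 + ‖yh - yc‖ ^ 2)) + R :=
    hg ▸ h xh yh hyh
  -- With `F` the proximal objective, `g` telescopes along `F(xb,yh) ≥ F(xb,ys) ≥ F(xs,ys) ≥
  -- F(xs,yb) ≥ F(xh,yb)`. Each drop dominates a quadratic, so `g` controls each distance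
  -- separately.
  have e1 : ρ * ‖xh - xs‖ ^ 2 ≤ 2 * g := by
    rw [norm_sub_rev]
    linarith [hxh xs, hmax yb hyb, hsad xb, hmaxh ys hys, posμ (yb - ys), posρ (xb - xs),
      posμ (ys - yh)]
  have e2 : ρ * ‖xb - xs‖ ^ 2 ≤ 2 * g := by
    linarith [hxh xs, hmax yb hyb, hsad xb, hmaxh ys hys, posμ (yb - ys), posρ (xs - xh),
      posμ (ys - yh)]
  have e3 : μy * ‖yh - ys‖ ^ 2 ≤ 2 * g := by
    rw [norm_sub_rev]
    linarith [hxh xs, hmax yb hyb, hsad xb, hmaxh ys hys, posμ (yb - ys), posρ (xs - xh),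
      posρ (xb - xs)]
  have e4 : ρ * ‖xb - xh‖ ^ 2 ≤ 2 * g := by
    linarith [hxh xb, hmaxh yb hyb, posμ (yb - yh)]
  have hΓ0 := proxGap_eq (Y := Y) hρ hx0
  have hΓ1 := proxGap_eq (Y := Y) hρ hx1
  have e6 : μy * ‖ys - yc‖ ^ 2 ≤ 2 * proxGap f Y ρ xc yc := by
    rw [norm_sub_rev]
    linarith [hA.le_primal hμy xc hys, hsad xc, hmax yc hyc, hx0 xs, posρ (xs - x0),
      posρ (xc - xs)]
  have hP0 : primal f Y xs + 3 / 2 * (ρ * ‖xs - xc‖ ^ 2) ≤ primal f Y xc := by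
    have := hsad xc
    rw [norm_sub_rev xc xs] at this
    linarith [hA.le_primal hμy xc hys]
  have e5 : ρ * ‖xs - xc‖ ^ 2 ≤ 2 * proxGap f Y ρ xc yc := by
    have := hsad xc
    rw [norm_sub_rev xc xs] at this
    linarith [hA.le_primal hμy xc hys, hmax yc hyc, hx0 xs, posρ (xs - x0), posμ (yc - ys)]
  have hu : max μ μx * (primal f Y xs - sInf (Set.range (primal f Y))) ≤
      2 * ρ * (ρ * ‖xs - xc‖ ^ 2) := by
    have := hA.primal_PL_max hμy hμx xs
    rw [hgs, norm_smul, Real.norm_of_nonneg (by positivity), norm_sub_rev xc xs] at this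
    linarith
  have hP1 : primal f Y xb ≤ primal f Y xs + ρ * ‖xs - xc‖ ^ 2 + g := by
    linarith [hxh xs, hmax yb hyb, posμ (yb - ys), posρ (xs - xh), posρ (xb - xc)]
  -- Quadratic growth at `xh` and the recentring inequality give `g + ρ‖xb - xh‖² + 3ρ‖xb - xc‖²`.
  -- The middle term is at most `2g`, the last at most `12g + 6u`.
  have hΓ1' : proxGap f Y ρ xb yb ≤ 15 * g + 6 * (ρ * ‖xs - xc‖ ^ 2) := by
    have h1 := mul_le_mul_of_nonneg_left (norm_sub_sq_recentre x1 xh xb xc) hρ.le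
    have h2 := mul_le_mul_of_nonneg_left (norm_sub_sq_le_two_mul xb xs xc) hρ.le
    linarith [hxh x1]
  -- Pass through the saddle point: its distance to the best responses is controlled by `g`, its
  -- distance to the centre by the old proximal gap.
  have hmin : min ρ μy * (‖xh - xc‖ ^ 2 + ‖yh - yc‖ ^ 2) ≤
      8 * (g + proxGap f Y ρ xc yc) := by
    have h1 := mul_le_mul_of_nonneg_left (norm_sub_sq_le_two_mul xh xs xc) hρ.le
    have h2 := mul_le_mul_of_nonneg_left (norm_sub_sq_le_two_mul yh ys yc) hμy.le
    have h3 := mul_le_mul_of_nonneg_right (min_le_left ρ μy) (sq_nonneg ‖xh - xc‖)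
    have h4 := mul_le_mul_of_nonneg_right (min_le_right ρ μy) (sq_nonneg ‖yh - yc‖)
    linarith
  have hg0 : 0 ≤ g := by linarith [posρ (xb - xs)]
  have hΓ0nn := hA.proxGap_nonneg hρ hμy xc hyc
  have hb : 0 ≤ primal f Y xs - sInf (Set.range (primal f Y)) := sub_nonneg.2 hA.primal_ge
  have hν : 0 < max μ μx := lt_max_of_lt_left hμ
  exact proxRate_contraction hρ hν hb hΓ0nn hg0 hu (by linarith) (by linarith) hΓ1' (by linarith)

end MinMaxAssumptions

/-! ### The dual averaging step: growth, stability and progress -/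

section DualAveraging

variable {ι : Type*} [Fintype ι]

lemma EuclideanSpace.real_inner_eq_sum (x y : EuclideanSpace ℝ ι) :
    inner ℝ x y = ∑ i, x i * y i := by
  simp [PiLp.inner_apply, mul_comm]

/-- The dual averaging objective `⟨z, v⟩ + ½ ∑ hᵢ (zᵢ - z₀ᵢ)²`. -/
def daObjective (v : EuclideanSpace ℝ ι) (h : ι → ℝ) (z₀ z : EuclideanSpace ℝ ι) : ℝ :=
  inner ℝ z v + 1 / 2 * ∑ i, h i * (z i - z₀ i) ^ 2

lemma daObjective_segment (v : EuclideanSpace ℝ ι) (h : ι → ℝ) (z₀ z w : EuclideanSpace ℝ ι)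
    (t : ℝ) :
    daObjective v h z₀ ((1 - t) • z + t • w) = (1 - t) * daObjective v h z₀ z +
      t * daObjective v h z₀ w - t * ((1 - t) * (1 / 2 * ∑ i, h i * (w i - z i) ^ 2)) := by
  simp only [daObjective, EuclideanSpace.real_inner_eq_sum, Finset.mul_sum,
    ← Finset.sum_add_distrib, ← Finset.sum_sub_distrib]
  refine Finset.sum_congr rfl fun i _ => ?_
  simp only [PiLp.add_apply, PiLp.smul_apply, smul_eq_mul]
  ring

lemma daObjective_growth {S : Set (EuclideanSpace ℝ ι)} (hS : Convex ℝ S)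
    {v : EuclideanSpace ℝ ι} {h : ι → ℝ} {z₀ z : EuclideanSpace ℝ ι} (hz : z ∈ S)
    (hmin : IsMinOn (daObjective v h z₀) S z) {w : EuclideanSpace ℝ ι} (hw : w ∈ S) :
    daObjective v h z₀ z + 1 / 2 * ∑ i, h i * (w i - z i) ^ 2 ≤ daObjective v h z₀ w := by
  have : 1 / 2 * ∑ i, h i * (w i - z i) ^ 2 ≤ daObjective v h z₀ w - daObjective v h z₀ z := by
    refine le_of_forall_one_sub_mul_le fun t h0 h1 => ?_
    have h3 : daObjective v h z₀ z ≤ daObjective v h z₀ ((1 - t) • z + t • w) :=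
      hmin (hS hz hw (sub_nonneg.2 h1.le) h0.le (by ring))
    rw [daObjective_segment] at h3
    refine le_of_mul_le_mul_left ?_ h0
    linarith
  linarith

lemma mul_norm_sq_le_sum {δ : ℝ} {h : ι → ℝ} (hh : ∀ i, δ ≤ h i) (z : EuclideanSpace ℝ ι) :
    δ * ‖z‖ ^ 2 ≤ ∑ i, h i * z i ^ 2 := by
  rw [EuclideanSpace.real_norm_sq_eq, Finset.mul_sum]
  exact Finset.sum_le_sum fun i _ => mul_le_mul_of_nonneg_right (hh i) (sq_nonneg _)

lemma continuous_daObjective (v : EuclideanSpace ℝ ι) (h : ι → ℝ) (z₀ : EuclideanSpace ℝ ι) :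
    Continuous (daObjective v h z₀) := by
  unfold daObjective
  fun_prop

lemma exists_isMinOn_daObjective {S : Set (EuclideanSpace ℝ ι)} (hS : IsClosed S)
    (hne : S.Nonempty) {δ : ℝ} (hδ : 0 < δ) (v : EuclideanSpace ℝ ι) {h : ι → ℝ}
    (hh : ∀ i, δ ≤ h i) (z₀ : EuclideanSpace ℝ ι) :
    ∃ z, z ∈ S ∧ IsMinOn (daObjective v h z₀) S z := by
  obtain ⟨w, hw⟩ := hne
  refine (continuous_daObjective v h z₀).continuousOn.exists_isMinOn' hS hw ?_
  set B := daObjective v h z₀ w - inner ℝ z₀ v with hB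
  have := (isCompact_closedBall z₀ (max 1 ((‖v‖ + |B|) / (δ / 2)))).compl_mem_cocompact
  rw [Filter.eventually_inf_principal]
  filter_upwards [this] with z hz _
  simp only [Set.mem_compl_iff, Metric.mem_closedBall, not_le, dist_eq_norm, max_lt_iff] at hz
  obtain ⟨h1, h2⟩ := hz
  rw [div_lt_iff₀ (by positivity)] at h2
  have h3 := mul_norm_sq_le_sum hh (z - z₀)
  have h4 := neg_le_of_abs_le (abs_real_inner_le_norm (z - z₀) v)
  have h5 := le_abs_self B
  have h6 : |B| ≤ ‖z - z₀‖ * |B| := le_mul_of_one_le_left (abs_nonneg _) h1.le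
  have h7 : inner ℝ z v = inner ℝ z₀ v + inner ℝ (z - z₀) v := by
    rw [← inner_add_left, add_sub_cancel]
  simp only [PiLp.sub_apply] at h3
  have h8 : daObjective v h z₀ z = inner ℝ z v + 1 / 2 * ∑ i, h i * (z i - z₀ i) ^ 2 := rfl
  have h9 := mul_le_mul_of_nonneg_left h2.le (norm_nonneg (z - z₀))
  linarith

/-- The dual averaging step. -/
def daStep (S : Set (EuclideanSpace ℝ ι)) (v : EuclideanSpace ℝ ι) (h : ι → ℝ)
    (z₀ : EuclideanSpace ℝ ι) : EuclideanSpace ℝ ι :=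
  argminOn (daObjective v h z₀) S

lemma daStep_spec {S : Set (EuclideanSpace ℝ ι)} (hS : IsClosed S)
    (hne : S.Nonempty) {δ : ℝ} (hδ : 0 < δ) (v : EuclideanSpace ℝ ι) {h : ι → ℝ}
    (hh : ∀ i, δ ≤ h i) (z₀ : EuclideanSpace ℝ ι) :
    daStep S v h z₀ ∈ S ∧ IsMinOn (daObjective v h z₀) S (daStep S v h z₀) :=
  Classical.epsilon_spec (exists_isMinOn_daObjective hS hne hδ v hh z₀)

/-- Stability of the dual averaging step in its parameters. -/
lemma norm_daStep_sub_le {S : Set (EuclideanSpace ℝ ι)} (hS : IsClosed S) (hSc : Convex ℝ S)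
    (hne : S.Nonempty) {δ : ℝ} (hδ : 0 < δ) (v v' : EuclideanSpace ℝ ι) {h h' : ι → ℝ}
    (hh : ∀ i, δ ≤ h i) (hh' : ∀ i, δ ≤ h' i) (z₀ z₀' : EuclideanSpace ℝ ι) :
    ‖daStep S v h z₀ - daStep S v' h' z₀'‖ ≤ ‖WithLp.toLp 2 fun i => v' i - v i +
      h' i * (daStep S v' h' z₀' i - z₀' i) - h i * (daStep S v' h' z₀' i - z₀ i)‖ / δ := by
  obtain ⟨hz, hm⟩ := daStep_spec hS hne hδ v hh z₀
  obtain ⟨hz', hm'⟩ := daStep_spec hS hne hδ v' hh' z₀'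
  have g1 := daObjective_growth hSc hz hm hz'
  have g2 := daObjective_growth hSc hz' hm' hz
  generalize daStep S v h z₀ = z at *
  generalize daStep S v' h' z₀' = z' at *
  set c : EuclideanSpace ℝ ι := WithLp.toLp 2 fun i => v' i - v i +
      h' i * (z' i - z₀' i) - h i * (z' i - z₀ i) with hc
  -- Add the two growth inequalities, each minimiser tested against the other; everything except the
  -- pairing with the parameter change `c` cancels.
  have key : ∑ i, h i * (z - z') i ^ 2 ≤ inner ℝ (z - z') c := by
    rw [EuclideanSpace.real_inner_eq_sum]
    have e : inner ℝ z v + inner ℝ z' v' + (1 / 2 * ∑ i, h i * (z' i - z i) ^ 2) +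
        (1 / 2 * ∑ i, h' i * (z i - z' i) ^ 2) + (1 / 2 * ∑ i, h i * (z i - z₀ i) ^ 2) +
        (1 / 2 * ∑ i, h' i * (z' i - z₀' i) ^ 2) - inner ℝ z v' - inner ℝ z' v -
        (1 / 2 * ∑ i, h i * (z' i - z₀ i) ^ 2) - (1 / 2 * ∑ i, h' i * (z i - z₀' i) ^ 2) =
        ∑ i, h i * (z - z') i ^ 2 - ∑ i, (z - z') i * c i := by
      simp only [EuclideanSpace.real_inner_eq_sum, Finset.mul_sum,
        ← Finset.sum_add_distrib, ← Finset.sum_sub_distrib]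
      refine Finset.sum_congr rfl fun i _ => ?_
      simp only [PiLp.sub_apply, hc]
      ring
    simp only [daObjective] at g1 g2
    linarith
  have h1 := (mul_norm_sq_le_sum hh (z - z')).trans (key.trans (real_inner_le_norm _ _))
  rw [le_div_iff₀ hδ]
  rcases (norm_nonneg (z - z')).eq_or_lt with h0 | h0
  · rw [← h0]; simp
  · refine le_of_mul_le_mul_left ?_ h0
    linarith

/-- The stability bound vanishes when the parameters coincide. Continuity is wanted because it makes
the iterates, defined by a choice of minimiser, measurable in the samples. -/
lemma continuous_daStep {S : Set (EuclideanSpace ℝ ι)} (hS : IsClosed S) (hSc : Convex ℝ S)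
    (hne : S.Nonempty) {δ : ℝ} (hδ : 0 < δ) {X : Type*} [TopologicalSpace X]
    {v : X → EuclideanSpace ℝ ι} {h : X → ι → ℝ} {z₀ : X → EuclideanSpace ℝ ι}
    (hv : Continuous v) (hhc : Continuous h) (hz₀ : Continuous z₀) (hh : ∀ x i, δ ≤ h x i) :
    Continuous fun x => daStep S (v x) (h x) (z₀ x) := by
  rw [continuous_iff_continuousAt]
  intro x'
  rw [ContinuousAt, tendsto_iff_norm_sub_tendsto_zero]
  refine squeeze_zero (fun _ => norm_nonneg _)
    (fun x => norm_daStep_sub_le hS hSc hne hδ (v x) (v x') (hh x) (hh x') (z₀ x) (z₀ x')) ?_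
  have : Continuous fun x => ‖(WithLp.toLp 2 fun i => v x' i - v x i +
      h x' i * (daStep S (v x') (h x') (z₀ x') i - z₀ x' i) -
      h x i * (daStep S (v x') (h x') (z₀ x') i - z₀ x i) : EuclideanSpace ℝ ι)‖ / δ := by
    have := fun i => (continuous_apply i).comp hhc
    simp only [Function.comp_def] at this
    fun_prop
  have h0 := this.tendsto x'
  have e : (fun i => v x' i - v x' i +
      h x' i * (daStep S (v x') (h x') (z₀ x') i - z₀ x' i) -
      h x' i * (daStep S (v x') (h x') (z₀ x') i - z₀ x' i)) = 0 := by
    ext i; simp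
  rw [e] at h0
  simpa using h0

/-- Distance travelled by the dual averaging step. -/
lemma norm_daStep_sub_center_le {S : Set (EuclideanSpace ℝ ι)} (hS : IsClosed S) (hSc : Convex ℝ S)
    {δ : ℝ} (hδ : 0 < δ) (v : EuclideanSpace ℝ ι) {h : ι → ℝ}
    (hh : ∀ i, δ ≤ h i) {z₀ : EuclideanSpace ℝ ι} (hz₀ : z₀ ∈ S) :
    ‖daStep S v h z₀ - z₀‖ ≤ ‖v‖ / δ := by
  obtain ⟨hz, hm⟩ := daStep_spec hS ⟨z₀, hz₀⟩ hδ v hh z₀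
  have g1 := daObjective_growth hSc hz hm hz₀
  generalize daStep S v h z₀ = z at *
  have h1 := mul_norm_sq_le_sum hh (z - z₀)
  have h2 := neg_le_of_abs_le (abs_real_inner_le_norm (z - z₀) v)
  have e : ∑ i, h i * (z₀ i - z i) ^ 2 = ∑ i, h i * (z - z₀) i ^ 2 :=
    Finset.sum_congr rfl fun i _ => by simp only [PiLp.sub_apply]; ring
  simp only [daObjective] at g1
  rw [e] at g1
  simp only [PiLp.sub_apply, sub_self] at g1 h1
  rw [inner_sub_left] at h2
  rw [le_div_iff₀ hδ]
  simp at g1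
  rcases (norm_nonneg (z - z₀)).eq_or_lt with h0 | h0
  · rw [← h0]; simp
  · refine le_of_mul_le_mul_left ?_ h0
    linarith

/-- Completing the square. It serves twice: for the stability term of the regret and for absorbing
the noise paired with the comparator. -/
lemma mul_add_sq_ge {η h g w : ℝ} (hh : 0 < h) :
    -(η ^ 2 / 2 * (g ^ 2 / h)) ≤ η * (w * g) + 1 / 2 * (h * w ^ 2) := by
  have : η * (w * g) + 1 / 2 * (h * w ^ 2) + η ^ 2 / 2 * (g ^ 2 / h) =
      1 / 2 * ((h * w + η * g) ^ 2 / h) := by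
    field_simp
    ring
  have h2 : 0 ≤ 1 / 2 * ((h * w + η * g) ^ 2 / h) := by positivity
  linarith

/-- One-step progress in the regret analysis of dual averaging. -/
lemma daObjective_step {S : Set (EuclideanSpace ℝ ι)} (hSc : Convex ℝ S)
    {v g : EuclideanSpace ℝ ι} {h h' : ι → ℝ} {z₀ z w : EuclideanSpace ℝ ι} {η : ℝ}
    (hpos : ∀ i, 0 < h i) (hmono : ∀ i, h i ≤ h' i)
    (hz : z ∈ S) (hmin : IsMinOn (daObjective (η • v) h z₀) S z) (hw : w ∈ S) :
    daObjective (η • v) h z₀ z + η * inner ℝ z g - η ^ 2 / 2 * ∑ i, g i ^ 2 / h i ≤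
      daObjective (η • (v + g)) h' z₀ w := by
  have h1 := daObjective_growth hSc hz hmin hw
  have h2 : daObjective (η • v) h z₀ w + η * inner ℝ w g ≤ daObjective (η • (v + g)) h' z₀ w := by
    simp only [daObjective, smul_add, inner_add_right, inner_smul_right]
    have : ∑ i, h i * (w i - z₀ i) ^ 2 ≤ ∑ i, h' i * (w i - z₀ i) ^ 2 :=
      Finset.sum_le_sum fun i _ => mul_le_mul_of_nonneg_right (hmono i) (sq_nonneg _)
    linarith
  have h3 : -(η ^ 2 / 2 * ∑ i, g i ^ 2 / h i) ≤
      η * inner ℝ (w - z) g + 1 / 2 * ∑ i, h i * (w i - z i) ^ 2 := by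
    simp only [EuclideanSpace.real_inner_eq_sum, Finset.mul_sum, ← Finset.sum_add_distrib,
      ← Finset.sum_neg_distrib]
    exact Finset.sum_le_sum fun i _ => mul_add_sq_ge (hpos i)
  rw [inner_sub_left] at h3
  linarith

end DualAveraging

/-! ### Pathwise regret of AdaGrad -/

section AdaGrad

variable {d d' : ℕ} {Ξ : Type*} {G : JointVec d d' → Ξ → JointVec d d'} {Y : Set (Vec d')}
  {δ η : ℝ} {z₀ : JointVec d d'} {s : ℕ → Ξ}

/-- The feasible set `ℝ^d × Y`. -/
def feasible (d : ℕ) {d' : ℕ} (Y : Set (Vec d')) : Set (JointVec d d') := {z | yPart z ∈ Y}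

lemma continuous_xPart : Continuous (xPart : JointVec d d' → Vec d) := by
  unfold xPart
  fun_prop

lemma continuous_yPart : Continuous (yPart : JointVec d d' → Vec d') := by
  unfold yPart
  fun_prop

lemma yPart_add (z w : JointVec d d') : yPart (z + w) = yPart z + yPart w := by
  ext i; simp [yPart]

lemma yPart_smul (t : ℝ) (z : JointVec d d') : yPart (t • z) = t • yPart z := by
  ext i; simp [yPart]

lemma isClosed_feasible (hY : IsClosed Y) : IsClosed (feasible d Y) :=
  hY.preimage continuous_yPart

lemma convex_feasible (hY : Convex ℝ Y) : Convex ℝ (feasible d Y) := by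
  intro z hz w hw a b ha hb hab
  simp only [feasible, Set.mem_ofPred_eq, yPart_add, yPart_smul] at *
  exact hY hz hw ha hb hab

/-- The `t`-th gradient seen by AdaGrad. -/
def adaGradient (G : JointVec d d' → Ξ → JointVec d d') (Y : Set (Vec d')) (δ η : ℝ)
    (z₀ : JointVec d d') (s : ℕ → Ξ) (t : ℕ) : JointVec d d' :=
  G (adaState G Y δ η z₀ s t).point (s t)

/-- The diagonal of `H_t`. -/
def adaDiag (G : JointVec d d' → Ξ → JointVec d d') (Y : Set (Vec d')) (δ η : ℝ)
    (z₀ : JointVec d d') (s : ℕ → Ξ) (t : ℕ) (i : Fin d ⊕ Fin d') : ℝ :=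
  δ + √((adaState G Y δ η z₀ s t).sqSum i)

/-- Proportional objectives have the same minimiser predicate, so the choice operator returns the
same point. This removes the factor `1/t` from the AdaGrad update. -/
lemma argminOn_congr {E : Type*} [Nonempty E] {φ ψ : E → ℝ} {S : Set E} {c : ℝ} (hc : 0 < c)
    (h : ∀ z, φ z = c * ψ z) : argminOn φ S = argminOn ψ S := by
  unfold argminOn
  congr 1
  funext z
  simp only [IsMinOn, IsMinFilter, h, mul_le_mul_iff_right₀ hc]

lemma adaState_point_succ (t : ℕ) : (adaState G Y δ η z₀ s (t + 1)).point =
    daStep (feasible d Y) (η • (adaState G Y δ η z₀ s (t + 1)).gradSum)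
      (adaDiag G Y δ η z₀ s (t + 1)) z₀ := by
  refine argminOn_congr (c := 1 / ((t : ℝ) + 1)) (by positivity) fun z => ?_
  simp only [daObjective, adaState, inner_smul_right, adaDiag]
  ring

lemma adaState_gradSum_succ (t : ℕ) : (adaState G Y δ η z₀ s (t + 1)).gradSum =
    (adaState G Y δ η z₀ s t).gradSum + adaGradient G Y δ η z₀ s t := rfl

lemma adaState_sqSum_succ (t : ℕ) (i : Fin d ⊕ Fin d') :
    (adaState G Y δ η z₀ s (t + 1)).sqSum i =
      (adaState G Y δ η z₀ s t).sqSum i + adaGradient G Y δ η z₀ s t i ^ 2 := rfl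

lemma adaState_sqSum_nonneg (t : ℕ) (i : Fin d ⊕ Fin d') :
    0 ≤ (adaState G Y δ η z₀ s t).sqSum i := by
  induction t with
  | zero => exact le_rfl
  | succ t ih => rw [adaState_sqSum_succ]; positivity

lemma le_adaDiag (t : ℕ) (i : Fin d ⊕ Fin d') : δ ≤ adaDiag G Y δ η z₀ s t i :=
  le_add_of_nonneg_right (Real.sqrt_nonneg _)

lemma adaDiag_mono (t : ℕ) (i : Fin d ⊕ Fin d') :
    adaDiag G Y δ η z₀ s t i ≤ adaDiag G Y δ η z₀ s (t + 1) i := by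
  unfold adaDiag
  gcongr
  rw [adaState_sqSum_succ]
  exact le_add_of_nonneg_right (sq_nonneg _)

lemma adaState_point_spec (hY : IsClosed Y) (hδ : 0 < δ) (hz₀ : z₀ ∈ feasible d Y)
    (t : ℕ) : (adaState G Y δ η z₀ s t).point ∈ feasible d Y ∧
      IsMinOn (daObjective (η • (adaState G Y δ η z₀ s t).gradSum) (adaDiag G Y δ η z₀ s t) z₀)
        (feasible d Y) (adaState G Y δ η z₀ s t).point := by
  cases t with
  | zero =>
    refine ⟨hz₀, fun z _ => ?_⟩
    simp only [adaState, daObjective, Set.mem_ofPred_eq, smul_zero, inner_zero_right, sub_self]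
    have : 0 ≤ ∑ i, adaDiag G Y δ η z₀ s 0 i * (z i - z₀ i) ^ 2 :=
      Finset.sum_nonneg fun i _ => mul_nonneg (hδ.le.trans (le_adaDiag 0 i)) (sq_nonneg _)
    simpa using this
  | succ t =>
    rw [adaState_point_succ]
    exact daStep_spec (isClosed_feasible hY) ⟨z₀, hz₀⟩ hδ _ (le_adaDiag _) _

/-- The pathwise regret bound of AdaGrad with dual averaging. -/
lemma adaGrad_regret (hY : IsClosed Y) (hYc : Convex ℝ Y) (hδ : 0 < δ) (hz₀ : z₀ ∈ feasible d Y)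
    (T : ℕ) {w : JointVec d d'} (hw : w ∈ feasible d Y) :
    η * ∑ t ∈ Finset.range T,
        inner ℝ ((adaState G Y δ η z₀ s t).point - w) (adaGradient G Y δ η z₀ s t) ≤
      1 / 2 * ∑ i, adaDiag G Y δ η z₀ s T i * (w i - z₀ i) ^ 2 +
        η ^ 2 / 2 * ∑ t ∈ Finset.range T,
          ∑ i, adaGradient G Y δ η z₀ s t i ^ 2 / adaDiag G Y δ η z₀ s t i := by
  have key : ∀ T, ∀ w ∈ feasible d Y, η * ∑ t ∈ Finset.range T,
        inner ℝ ((adaState G Y δ η z₀ s t).point) (adaGradient G Y δ η z₀ s t) -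
        η ^ 2 / 2 * ∑ t ∈ Finset.range T,
          ∑ i, adaGradient G Y δ η z₀ s t i ^ 2 / adaDiag G Y δ η z₀ s t i ≤
      daObjective (η • (adaState G Y δ η z₀ s T).gradSum) (adaDiag G Y δ η z₀ s T) z₀ w := by
    intro T
    induction T with
    | zero =>
      intro w hw
      have := (adaState_point_spec (G := G) (s := s) (η := η) hY hδ hz₀ 0).2 hw
      simpa [daObjective, adaState] using this
    | succ T ih =>
      intro w hw
      obtain ⟨hz, hm⟩ := adaState_point_spec (G := G) (s := s) (η := η) hY hδ hz₀ T
      have h1 := daObjective_step (convex_feasible hYc) (g := adaGradient G Y δ η z₀ s T)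
        (fun i => hδ.trans_le (le_adaDiag T i)) (fun i => adaDiag_mono T i) hz hm hw
      have h2 := ih _ hz
      rw [adaState_gradSum_succ, Finset.sum_range_succ, Finset.sum_range_succ]
      linarith
  have h1 := key T w hw
  have h2 : (adaState G Y δ η z₀ s T).gradSum =
      ∑ t ∈ Finset.range T, adaGradient G Y δ η z₀ s t := by
    clear key h1
    induction T with
    | zero => simp [adaState]
    | succ T ih => rw [adaState_gradSum_succ, Finset.sum_range_succ, ih]
  simp only [inner_sub_left, Finset.sum_sub_distrib]
  simp only [daObjective, inner_smul_right, h2, inner_sum] at h1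
  linarith

/-- The preconditioner dividing `g²` does not yet contain `g`. Since `|g| ≤ δ`, the summand `δ`
makes up for this: `√(q + g²) ≤ δ + √q`, after which `g²` is factored as a difference of squares. -/
lemma sq_div_le_two_mul_sqrt_sub {δ q g : ℝ} (hδ : 0 < δ) (hq : 0 ≤ q) (hg : |g| ≤ δ) :
    g ^ 2 / (δ + √q) ≤ 2 * (√(q + g ^ 2) - √q) := by
  have hs := Real.sqrt_nonneg q
  have hs' := Real.sqrt_nonneg (q + g ^ 2)
  have h1 := Real.sq_sqrt hq
  have h2 := Real.sq_sqrt (show 0 ≤ q + g ^ 2 by positivity)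
  have hle : √q ≤ √(q + g ^ 2) := Real.sqrt_le_sqrt (le_add_of_nonneg_right (sq_nonneg _))
  have hg2 : g ^ 2 ≤ δ ^ 2 := sq_le_sq' (neg_le_of_abs_le hg) (le_of_abs_le hg)
  have hle' : √(q + g ^ 2) ≤ δ + √q := Real.sqrt_le_iff.2 ⟨by positivity, by nlinarith⟩
  rw [div_le_iff₀ (by positivity)]
  nlinarith

/-- The sum of the normalised squared gradients is controlled by `∑ᵢ ‖g_{1:T,i}‖`. -/
lemma adaGrad_sum_sq_div_le (hδ : 0 < δ) (T : ℕ)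
    (hb : ∀ t < T, ∀ i, |adaGradient G Y δ η z₀ s t i| ≤ δ) :
    ∑ t ∈ Finset.range T, ∑ i, adaGradient G Y δ η z₀ s t i ^ 2 / adaDiag G Y δ η z₀ s t i ≤
      2 * ∑ i, √((adaState G Y δ η z₀ s T).sqSum i) := by
  induction T with
  | zero => simp [adaState]
  | succ T ih =>
    rw [Finset.sum_range_succ]
    have h1 := ih fun t ht => hb t (ht.trans (Nat.lt_succ_self T))
    have h2 : ∑ i, adaGradient G Y δ η z₀ s T i ^ 2 / adaDiag G Y δ η z₀ s T i ≤
        ∑ i, 2 * (√((adaState G Y δ η z₀ s (T + 1)).sqSum i) -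
          √((adaState G Y δ η z₀ s T).sqSum i)) :=
      Finset.sum_le_sum fun i _ =>
        sq_div_le_two_mul_sqrt_sub hδ (adaState_sqSum_nonneg T i) (hb T (Nat.lt_succ_self T) i)
    rw [← Finset.mul_sum, Finset.sum_sub_distrib] at h2
    linarith

end AdaGrad

/-! ### From regret to the gap of the proximal problem -/

section PathwiseGap

variable {d d' : ℕ}

@[simp] lemma xPart_joinVec (x : Vec d) (y : Vec d') : xPart (joinVec x y) = x := rfl

@[simp] lemma yPart_joinVec (x : Vec d) (y : Vec d') : yPart (joinVec x y) = y := rfl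

lemma inner_joint (z w : JointVec d d') :
    inner ℝ z w = inner ℝ (xPart z) (xPart w) + inner ℝ (yPart z) (yPart w) := by
  simp [EuclideanSpace.real_inner_eq_sum, Fintype.sum_sum_type, xPart, yPart]

lemma norm_sq_joint (z : JointVec d d') : ‖z‖ ^ 2 = ‖xPart z‖ ^ 2 + ‖yPart z‖ ^ 2 := by
  simp [EuclideanSpace.real_norm_sq_eq, Fintype.sum_sum_type, xPart, yPart]

lemma xPart_sub (z w : JointVec d d') : xPart (z - w) = xPart z - xPart w := rfl

lemma yPart_sub (z w : JointVec d d') : yPart (z - w) = yPart z - yPart w := rfl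

lemma xPart_sum {κ : Type*} (s : Finset κ) (z : κ → JointVec d d') :
    xPart (∑ t ∈ s, z t) = ∑ t ∈ s, xPart (z t) := by
  ext i; simp [xPart]

lemma yPart_sum {κ : Type*} (s : Finset κ) (z : κ → JointVec d d') :
    yPart (∑ t ∈ s, z t) = ∑ t ∈ s, yPart (z t) := by
  ext i; simp [yPart]

/-- The monotone operator of the proximal problem centred at `xc`. -/
def proxField (f : Vec d → Vec d' → ℝ) (ρ : ℝ) (xc : Vec d) (z : JointVec d d') : JointVec d d' :=
  joinVec (gradX f (xPart z) (yPart z) + (2 * ρ) • (xPart z - xc)) (-gradY f (xPart z) (yPart z))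

namespace MinMaxAssumptions

variable {f : Vec d → Vec d' → ℝ} {Y : Set (Vec d')} {ℓ L ρ μ μy μx ε₀ : ℝ}
  {x₀ : Vec d} {y₀ : Vec d'}

lemma prox_first_order (hA : MinMaxAssumptions f Y ℓ L ρ μ μy μx ε₀ x₀ y₀) (hρ : 0 < ρ)
    {y : Vec d'} (hy : y ∈ Y) (x x' xc : Vec d) :
    f x' y + ρ * ‖x' - xc‖ ^ 2 + inner ℝ (gradX f x' y + (2 * ρ) • (x' - xc)) (x - x') ≤
      f x y + ρ * ‖x - xc‖ ^ 2 := by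
  have h1 := hA.weakConvex x x' y hy
  have h2 : ‖x - xc‖ ^ 2 = ‖x - x'‖ ^ 2 + 2 * inner ℝ (x' - xc) (x - x') + ‖x' - xc‖ ^ 2 := by
    rw [real_inner_comm, ← norm_add_sq_real, sub_add_sub_cancel]
  have h3 : 0 ≤ ρ / 2 * ‖x - x'‖ ^ 2 := by positivity
  rw [h2, inner_add_left, real_inner_smul_left]
  linarith

lemma concave_first_order (hA : MinMaxAssumptions f Y ℓ L ρ μ μy μx ε₀ x₀ y₀) (hμy : 0 < μy)
    (x : Vec d) {y y' : Vec d'} (hy : y ∈ Y) (hy' : y' ∈ Y) :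
    f x y' ≤ f x y + inner ℝ (gradY f x y) (y' - y) := by
  have h1 := (hA.strongConcave x).le_add_inner_gradient hy hy' (hA.diffY x y hy)
  have h3 : 0 ≤ μy / 2 * ‖y' - y‖ ^ 2 := by positivity
  rw [gradY]
  linarith

/-- Convexity in `x` at fixed `y`-part and concavity in `y` at fixed `x`-part of `z`, added up; the
value of the proximal objective at `z` cancels. -/
lemma prox_monotone (hA : MinMaxAssumptions f Y ℓ L ρ μ μy μx ε₀ x₀ y₀) (hρ : 0 < ρ)
    (hμy : 0 < μy) (xc x : Vec d) {y : Vec d'} (hy : y ∈ Y) {z : JointVec d d'}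
    (hz : z ∈ feasible d Y) :
    f (xPart z) y + ρ * ‖xPart z - xc‖ ^ 2 - (f x (yPart z) + ρ * ‖x - xc‖ ^ 2) ≤
      inner ℝ (z - joinVec x y) (proxField f ρ xc z) := by
  have h1 := hA.prox_first_order hρ hz x (xPart z) xc
  have h2 := hA.concave_first_order hμy (xPart z) hz hy
  rw [inner_joint, xPart_sub, yPart_sub, proxField, xPart_joinVec, yPart_joinVec, xPart_joinVec,
    yPart_joinVec, inner_neg_right, ← neg_sub x, ← neg_sub y, inner_neg_left, inner_neg_left,
    real_inner_comm, real_inner_comm (gradY _ _ _)]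
  linarith

/-- The gap of the proximal problem at an average point is at most the average regret. -/
lemma prox_gap_average_le (hA : MinMaxAssumptions f Y ℓ L ρ μ μy μx ε₀ x₀ y₀) (hρ : 0 < ρ)
    (hμy : 0 < μy) (xc x : Vec d) {y : Vec d'} (hy : y ∈ Y) {T : ℕ} (hT : 0 < T)
    {z : ℕ → JointVec d d'} {zb : JointVec d d'} (hz : ∀ t, z t ∈ feasible d Y)
    (hzbY : zb ∈ feasible d Y)
    (hzb : zb = (1 / (T : ℝ)) • ∑ t ∈ Finset.range T, z t) :
    f (xPart zb) y + ρ * ‖xPart zb - xc‖ ^ 2 - (f x (yPart zb) + ρ * ‖x - xc‖ ^ 2) ≤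
      (∑ t ∈ Finset.range T, inner ℝ (z t - joinVec x y) (proxField f ρ xc (z t))) / T := by
  have hT' : (0 : ℝ) < T := by exact_mod_cast hT
  have hs : ∑ t ∈ Finset.range T, (z t - zb) = 0 := by
    rw [Finset.sum_sub_distrib, Finset.sum_const, Finset.card_range, hzb, ← Nat.cast_smul_eq_nsmul ℝ,
      smul_smul, mul_one_div_cancel hT'.ne', one_smul, sub_self]
  have hsx : ∑ t ∈ Finset.range T, (xPart (z t) - xPart zb) = 0 := by
    simp only [← xPart_sub, ← xPart_sum, hs]; rfl
  have hsy : ∑ t ∈ Finset.range T, (yPart (z t) - yPart zb) = 0 := by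
    simp only [← yPart_sub, ← yPart_sum, hs]; rfl
  have h1 : ∑ t ∈ Finset.range T, (f (xPart zb) y + ρ * ‖xPart zb - xc‖ ^ 2 +
      inner ℝ (gradX f (xPart zb) y + (2 * ρ) • (xPart zb - xc)) (xPart (z t) - xPart zb)) ≤
      ∑ t ∈ Finset.range T, (f (xPart (z t)) y + ρ * ‖xPart (z t) - xc‖ ^ 2) :=
    Finset.sum_le_sum fun t _ => hA.prox_first_order hρ hy _ _ _
  have h2 : ∑ t ∈ Finset.range T, (f x (yPart (z t)) + ρ * ‖x - xc‖ ^ 2) ≤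
      ∑ t ∈ Finset.range T, (f x (yPart zb) + ρ * ‖x - xc‖ ^ 2 +
        inner ℝ (gradY f x (yPart zb)) (yPart (z t) - yPart zb)) :=
    Finset.sum_le_sum fun t _ => by
      linarith [hA.concave_first_order hμy x hzbY (hz t)]
  have h3 := Finset.sum_le_sum fun t (_ : t ∈ Finset.range T) =>
    hA.prox_monotone hρ hμy xc x hy (hz t)
  rw [Finset.sum_add_distrib, ← inner_sum, hsx, inner_zero_right, add_zero, Finset.sum_const,
    Finset.card_range, nsmul_eq_mul] at h1
  rw [Finset.sum_add_distrib (f := fun t => f x (yPart zb) + ρ * ‖x - xc‖ ^ 2), ← inner_sum, hsy,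
    inner_zero_right, add_zero, Finset.sum_const, Finset.card_range, nsmul_eq_mul] at h2
  rw [Finset.sum_sub_distrib] at h3
  rw [le_div_iff₀ hT']
  linarith

end MinMaxAssumptions

variable {Ξ : Type*}

/-- The noise of the `t`-th stochastic gradient with respect to the operator `F`. -/
def adaNoise (F : JointVec d d' → JointVec d d') (G : JointVec d d' → Ξ → JointVec d d')
    (Y : Set (Vec d')) (δ η : ℝ) (z₀ : JointVec d d') (s : ℕ → Ξ) (t : ℕ) : JointVec d d' :=
  F (adaState G Y δ η z₀ s t).point - adaGradient G Y δ η z₀ s t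

/-- The error term in the pathwise analysis of AdaGrad. -/
def adaError (F : JointVec d d' → JointVec d d') (G : JointVec d d' → Ξ → JointVec d d')
    (Y : Set (Vec d')) (δ η : ℝ) (z₀ : JointVec d d') (s : ℕ → Ξ) (T : ℕ) : ℝ :=
  (η / 2 * (∑ t ∈ Finset.range T,
      ∑ i, adaGradient G Y δ η z₀ s t i ^ 2 / adaDiag G Y δ η z₀ s t i +
    ∑ i, (∑ t ∈ Finset.range T, adaNoise F G Y δ η z₀ s t i) ^ 2 / adaDiag G Y δ η z₀ s T i) +
    ∑ t ∈ Finset.range T,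
      inner ℝ ((adaState G Y δ η z₀ s t).point - z₀) (adaNoise F G Y δ η z₀ s t)) / T

lemma adaOutput_mem_feasible {G : JointVec d d' → Ξ → JointVec d d'} {Y : Set (Vec d')}
    {δ η : ℝ} {z₀ : JointVec d d'} {s : ℕ → Ξ} (hY : IsClosed Y) (hYc : Convex ℝ Y) (hδ : 0 < δ)
    (hz₀ : z₀ ∈ feasible d Y) {T : ℕ} (hT : 0 < T) :
    adaOutput G Y δ η z₀ s T ∈ feasible d Y := by
  have hT' : (0 : ℝ) < T := by exact_mod_cast hT
  rw [adaOutput, Finset.smul_sum]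
  refine (convex_feasible hYc).sum_mem (fun _ _ => by positivity) ?_
    fun t _ => (adaState_point_spec hY hδ hz₀ t).1
  simp [hT'.ne']

/-- The pathwise error bound of AdaGrad on the proximal problem. -/
theorem MinMaxAssumptions.adaGrad_gap_le {f : Vec d → Vec d' → ℝ} {Y : Set (Vec d')}
    {ℓ L ρ μ μy μx ε₀ : ℝ} {x₀ : Vec d} {y₀ : Vec d'}
    (hA : MinMaxAssumptions f Y ℓ L ρ μ μy μx ε₀ x₀ y₀) (hρ : 0 < ρ)
    (hμy : 0 < μy) {G : JointVec d d' → Ξ → JointVec d d'} {δ η B : ℝ} (hδ : 0 < δ) (hη : 0 < η)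
    {z₀ : JointVec d d'} (hz₀ : z₀ ∈ feasible d Y) {s : ℕ → Ξ} {T : ℕ} (hT : 0 < T)
    (hB : ∀ i, adaDiag G Y δ η z₀ s T i ≤ η * T * B) (x : Vec d) {y : Vec d'} (hy : y ∈ Y) :
    f (xPart (adaOutput G Y δ η z₀ s T)) y +
        ρ * ‖xPart (adaOutput G Y δ η z₀ s T) - xPart z₀‖ ^ 2 -
        (f x (yPart (adaOutput G Y δ η z₀ s T)) + ρ * ‖x - xPart z₀‖ ^ 2) ≤
      B * (‖x - xPart z₀‖ ^ 2 + ‖y - yPart z₀‖ ^ 2) +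
        adaError (proxField f ρ (xPart z₀)) G Y δ η z₀ s T := by
  have hT' : (0 : ℝ) < T := by exact_mod_cast hT
  have hw : joinVec x y ∈ feasible d Y := hy
  refine (hA.prox_gap_average_le hρ hμy (xPart z₀) x hy hT
    (fun t => (adaState_point_spec hA.closed hδ hz₀ t).1)
    (adaOutput_mem_feasible hA.closed hA.convex hδ hz₀ hT) rfl).trans ?_
  have hreg := adaGrad_regret (G := G) (η := η) (s := s) hA.closed hA.convex hδ hz₀ T hw
  set w := joinVec x y with hwdef
  set F := proxField f ρ (xPart z₀)
  set n : ℕ → JointVec d d' := adaNoise F G Y δ η z₀ s with hn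
  have h1 : ∀ t, inner ℝ ((adaState G Y δ η z₀ s t).point - w)
      (F (adaState G Y δ η z₀ s t).point) =
      inner ℝ ((adaState G Y δ η z₀ s t).point - w) (adaGradient G Y δ η z₀ s t) +
      (inner ℝ ((adaState G Y δ η z₀ s t).point - z₀) (n t) - inner ℝ (w - z₀) (n t)) := by
    intro t
    rw [← inner_sub_left, sub_sub_sub_cancel_right, ← inner_add_right, hn, adaNoise,
      add_sub_cancel]
  -- The comparator `w` may depend on the samples, so its pairing with the noise has no reason to
  -- average out. It is absorbed by half of the `H_T`-quadratic; the regret bound uses the other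
  -- half.
  have h2 : -(η ^ 2 / 2 * ∑ i, (∑ t ∈ Finset.range T, n t i) ^ 2 / adaDiag G Y δ η z₀ s T i) ≤
      η * ∑ t ∈ Finset.range T, inner ℝ (w - z₀) (n t) +
      1 / 2 * ∑ i, adaDiag G Y δ η z₀ s T i * (w i - z₀ i) ^ 2 := by
    have e : ∑ t ∈ Finset.range T, inner ℝ (w - z₀) (n t) =
        ∑ i, (w i - z₀ i) * ∑ t ∈ Finset.range T, n t i := by
      rw [← inner_sum, EuclideanSpace.real_inner_eq_sum]
      simp
    rw [e]
    simp only [Finset.mul_sum (s := Finset.univ), ← Finset.sum_add_distrib,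
      ← Finset.sum_neg_distrib]
    exact Finset.sum_le_sum fun i _ => mul_add_sq_ge (hδ.trans_le (le_adaDiag T i))
  have h3 : ∑ i, adaDiag G Y δ η z₀ s T i * (w i - z₀ i) ^ 2 ≤
      η * T * B * (‖x - xPart z₀‖ ^ 2 + ‖y - yPart z₀‖ ^ 2) := by
    have : ‖x - xPart z₀‖ ^ 2 + ‖y - yPart z₀‖ ^ 2 = ‖w - z₀‖ ^ 2 := by
      rw [norm_sq_joint]; rfl
    rw [this, EuclideanSpace.real_norm_sq_eq, Finset.mul_sum]
    exact Finset.sum_le_sum fun i _ => mul_le_mul_of_nonneg_right (hB i) (sq_nonneg _)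
  simp only [h1, Finset.sum_add_distrib, Finset.sum_sub_distrib]
  rw [adaError, ← hn, div_le_iff₀ hT', add_mul, div_mul_cancel₀ _ hT'.ne']
  refine le_of_mul_le_mul_left ?_ hη
  linarith

end PathwiseGap

/-! ### Unbiased sampling and martingale noise -/

/-- Sampling at a random point that is independent of the sample: the conditional mean is
measurable and bounded with respect to the past, and the noise is orthogonal to the past. -/
lemma unbiased_sampling {Ω Ξ E : Type*} {m : MeasurableSpace Ω} [mΩ : MeasurableSpace Ω]
    [MeasurableSpace Ξ] [MeasurableSpace E] {Pr : Measure Ω} [IsProbabilityMeasure Pr] (hm : m ≤ mΩ) {s : Ω → Ξ} (hs : Measurable s)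
    (hind : Indep m (MeasurableSpace.comap s inferInstance) Pr) {e : Ω → E}
    (he : Measurable[m] e) {φ : E × Ξ → ℝ} (hφ : Measurable φ) {u : E → ℝ} {S : Set E}
    (heS : ∀ ω, e ω ∈ S) (hu : ∀ x ∈ S, ∫ ω, φ (x, s ω) ∂Pr = u x) {C : ℝ}
    (hC : ∀ᵐ ω ∂Pr, |φ (e ω, s ω)| ≤ C) :
    Measurable[m] (fun ω => u (e ω)) ∧ (∀ᵐ ω ∂Pr, |u (e ω)| ≤ C) ∧
      ∀ W : Ω → ℝ, Measurable[m] W → MemLp W ⊤ Pr →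
        ∫ ω, W ω * (u (e ω) - φ (e ω, s ω)) ∂Pr = 0 := by
  have hsm : AEMeasurable s Pr := hs.aemeasurable
  have : IsProbabilityMeasure (Pr.map s) := Measure.isProbabilityMeasure_map hsm
  have hue : (fun ω => u (e ω)) = fun ω => ∫ y, φ (e ω, y) ∂(Pr.map s) := by
    ext ω
    rw [← hu _ (heS ω), integral_map hsm]
    exact (hφ.comp (measurable_const.prodMk measurable_id)).aestronglyMeasurable
  have hU : Measurable fun x => ∫ y, φ (x, y) ∂(Pr.map s) :=
    hφ.stronglyMeasurable.integral_prod_right'.measurable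
  have he' : Measurable e := he.mono hm le_rfl
  have hes : Measurable fun ω => (e ω, s ω) := he'.prodMk hs
  have hmeas : Measurable[m] (fun ω => u (e ω)) := hue ▸ hU.comp he
  have hbound : ∀ᵐ ω ∂Pr, |u (e ω)| ≤ C := by
    have hI : IndepFun e s Pr := by
      rw [IndepFun_iff_Indep]
      exact indep_of_indep_of_le_left hind he.comap_le
    have hset : MeasurableSet {p : E × Ξ | |φ p| ≤ C} := measurableSet_le hφ.abs measurable_const
    have h1 : ∀ᵐ p ∂((Pr.map e).prod (Pr.map s)), |φ p| ≤ C := by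
      rw [← (indepFun_iff_map_prod_eq_prod_map_map he'.aemeasurable hsm).1 hI,
        ae_map_iff hes.aemeasurable hset]
      exact hC
    filter_upwards [ae_of_ae_map he'.aemeasurable (Measure.ae_ae_of_ae_prod h1)] with ω hω
    rw [congrFun hue ω]
    simpa using norm_integral_le_of_norm_le_const (μ := Pr.map s) (f := fun y => φ (e ω, y)) hω
  refine ⟨hmeas, hbound, fun W hW hWb => ?_⟩
  have hW' : Measurable W := hW.mono hm le_rfl
  have hφb : MemLp (fun ω => φ (e ω, s ω)) ⊤ Pr :=
    memLp_top_of_bound (hφ.comp hes).aestronglyMeasurable C hC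
  have hub : MemLp (fun ω => u (e ω)) ⊤ Pr :=
    memLp_top_of_bound (hmeas.mono hm le_rfl).aestronglyMeasurable C hbound
  have hi1 : Integrable (fun ω => W ω * φ (e ω, s ω)) Pr :=
    (hφb.mul' hWb (r := ⊤)).integrable le_top
  have hi2 : Integrable (fun ω => W ω * u (e ω)) Pr := (hub.mul' hWb (r := ⊤)).integrable le_top
  simp only [mul_sub]
  rw [integral_sub hi2 hi1, sub_eq_zero]
  have hWe : Measurable fun ω => (W ω, e ω) := hW'.prodMk he'
  -- Taking `W` and `e` jointly lets Fubini on the product law integrate out the sample first, with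
  -- `W` as a constant factor.
  have hI : IndepFun (fun ω => (W ω, e ω)) s Pr := by
    rw [IndepFun_iff_Indep]
    exact indep_of_indep_of_le_left hind (hW.prodMk he).comap_le
  have hψ : Measurable fun p : (ℝ × E) × Ξ => p.1.1 * φ (p.1.2, p.2) := by fun_prop
  have hmap := (indepFun_iff_map_prod_eq_prod_map_map hWe.aemeasurable hsm).1 hI
  have hWes : Measurable fun ω => ((W ω, e ω), s ω) := hWe.prodMk hs
  have h1 : ∫ ω, W ω * φ (e ω, s ω) ∂Pr =
      ∫ p, p.1.1 * φ (p.1.2, p.2) ∂((Pr.map fun ω => (W ω, e ω)).prod (Pr.map s)) := by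
    rw [← hmap, integral_map hWes.aemeasurable hψ.aestronglyMeasurable]
  have hi3 : Integrable (fun p : (ℝ × E) × Ξ => p.1.1 * φ (p.1.2, p.2))
      ((Pr.map fun ω => (W ω, e ω)).prod (Pr.map s)) := by
    rw [← hmap, integrable_map_measure hψ.aestronglyMeasurable hWes.aemeasurable]
    exact hi1
  have : IsProbabilityMeasure (Pr.map fun ω => (W ω, e ω)) :=
    Measure.isProbabilityMeasure_map hWe.aemeasurable
  rw [h1, integral_prod _ hi3, integral_map hWe.aemeasurable
    hψ.stronglyMeasurable.integral_prod_right'.aestronglyMeasurable]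
  refine integral_congr_ae (Filter.Eventually.of_forall fun ω => ?_)
  have := congrFun hue ω
  simp only at this ⊢
  rw [integral_const_mul, this]

lemma memLp_top_div_of_le {Ω : Type*} [MeasurableSpace Ω] {Pr : Measure Ω} {δ : ℝ} (hδ : 0 < δ)
    {W h : Ω → ℝ} (hW : MemLp W ⊤ Pr)
    (hm : Measurable h) (hh : ∀ ω, δ ≤ h ω) : MemLp (fun ω => W ω / h ω) ⊤ Pr := by
  refine hW.of_le_mul (c := δ⁻¹) (hW.aestronglyMeasurable.aemeasurable.div
    hm.aemeasurable).aestronglyMeasurable (Filter.Eventually.of_forall fun ω => ?_)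
  rw [norm_div, div_eq_inv_mul, Real.norm_of_nonneg (hδ.le.trans (hh ω))]
  gcongr
  exact hh ω

/-- Normalised sums of martingale differences `F_t - g_t` are controlled in mean by the normalised
squares of the `g_t`. -/
lemma martingale_sq_div_le {Ω : Type*} [mΩ : MeasurableSpace Ω] {Pr : Measure Ω}
    [IsProbabilityMeasure Pr] {m : ℕ → MeasurableSpace Ω} (hmono : Monotone m) (hm : ∀ t, m t ≤ mΩ)
    {δ : ℝ} (hδ : 0 < δ) {g F h : ℕ → Ω → ℝ} {T : ℕ}
    (hg : ∀ t < T, Measurable[m (t + 1)] (g t)) (hgb : ∀ t < T, MemLp (g t) ⊤ Pr)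
    (hF : ∀ t < T, Measurable[m t] (F t)) (hFb : ∀ t < T, MemLp (F t) ⊤ Pr)
    (hh : ∀ t ≤ T, Measurable[m t] (h t)) (hhδ : ∀ t ω, δ ≤ h t ω)
    (hhm : ∀ t ω, h t ω ≤ h (t + 1) ω)
    (horth : ∀ t < T, ∀ W : Ω → ℝ, Measurable[m t] W → MemLp W ⊤ Pr →
      ∫ ω, W ω * (F t ω - g t ω) ∂Pr = 0) :
    MemLp (fun ω => (∑ t ∈ Finset.range T, (F t ω - g t ω)) ^ 2 / h T ω) ⊤ Pr ∧
      ∫ ω, (∑ t ∈ Finset.range T, (F t ω - g t ω)) ^ 2 / h T ω ∂Pr ≤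
        ∫ ω, ∑ t ∈ Finset.range T, g t ω ^ 2 / h t ω ∂Pr := by
  have hgq : ∀ t < T, MemLp (fun ω => g t ω ^ 2 / h t ω) ⊤ Pr := fun t ht => by
    refine memLp_top_div_of_le hδ ?_ ((hh t ht.le).mono (hm t) le_rfl) (hhδ t)
    simp only [sq]
    exact (hgb t ht).mul' (hgb t ht) (r := ⊤)
  have hN : ∀ t ≤ T, MemLp (fun ω => ∑ τ ∈ Finset.range t, (F τ ω - g τ ω)) ⊤ Pr := fun t ht =>
    memLp_finsetSum _ fun τ hτ =>
      (hFb τ ((Finset.mem_range.1 hτ).trans_le ht)).sub (hgb τ ((Finset.mem_range.1 hτ).trans_le ht))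
  have hNm : ∀ t ≤ T, Measurable[m t] (fun ω => ∑ τ ∈ Finset.range t, (F τ ω - g τ ω)) :=
    fun t ht => Finset.measurable_sum _ fun τ hτ => by
      have hτ' := Finset.mem_range.1 hτ
      exact ((hF τ (hτ'.trans_le ht)).mono (hmono hτ'.le) le_rfl).sub
        ((hg τ (hτ'.trans_le ht)).mono (hmono hτ') le_rfl)
  have hU : ∀ t ≤ T, MemLp (fun ω => (∑ τ ∈ Finset.range t, (F τ ω - g τ ω)) ^ 2 / h t ω) ⊤ Pr :=
    fun t ht => by
      refine memLp_top_div_of_le hδ ?_ ((hh t ht).mono (hm t) le_rfl) (hhδ t)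
      simp only [sq]
      exact (hN t ht).mul' (hN t ht) (r := ⊤)
  refine ⟨hU T le_rfl, ?_⟩
  have key : ∀ t ≤ T, ∫ ω, (∑ τ ∈ Finset.range t, (F τ ω - g τ ω)) ^ 2 / h t ω ∂Pr ≤
        ∫ ω, ∑ τ ∈ Finset.range t, g τ ω ^ 2 / h τ ω ∂Pr := by
    intro t
    induction t with
    | zero => simp
    | succ t ih =>
      intro ht
      have ht' : t < T := ht
      have hsum : MemLp (fun ω => ∑ τ ∈ Finset.range t, g τ ω ^ 2 / h τ ω) ⊤ Pr :=
        memLp_finsetSum _ fun τ hτ => hgq τ ((Finset.mem_range.1 hτ).trans ht')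
      set N : Ω → ℝ := fun ω => ∑ τ ∈ Finset.range t, (F τ ω - g τ ω) with hNdef
      -- Expanding `(N + F - g)²` as `N² + 2(N + F)(F - g) + g² - F²` puts the whole cross term on a
      -- weight known at time `t`; orthogonality kills it, and `-F²` is dropped. Thus raw squares
      -- `g²` appear instead of noise variances.
      set W : Ω → ℝ := fun ω => 2 * (N ω + F t ω) / h t ω with hW
      have hWm : Measurable[m t] W :=
        (((hNm t ht'.le).add (hF t ht')).const_mul 2).div (hh t ht'.le)
      have hWb : MemLp W ⊤ Pr := memLp_top_div_of_le hδ
        (((hN t ht'.le).add (hFb t ht')).const_mul 2) ((hh t ht'.le).mono (hm t) le_rfl) (hhδ t)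
      have hWn : MemLp (fun ω => W ω * (F t ω - g t ω)) ⊤ Pr :=
        ((hFb t ht').sub (hgb t ht')).mul' hWb (r := ⊤)
      have hpt : ∀ ω, (∑ τ ∈ Finset.range (t + 1), (F τ ω - g τ ω)) ^ 2 / h (t + 1) ω ≤
          N ω ^ 2 / h t ω + W ω * (F t ω - g t ω) + g t ω ^ 2 / h t ω := by
        intro ω
        have hp : 0 < h t ω := hδ.trans_le (hhδ t ω)
        rw [Finset.sum_range_succ]
        calc (N ω + (F t ω - g t ω)) ^ 2 / h (t + 1) ω
            ≤ (N ω + (F t ω - g t ω)) ^ 2 / h t ω := by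
              gcongr
              exact hhm t ω
          _ = N ω ^ 2 / h t ω + W ω * (F t ω - g t ω) + g t ω ^ 2 / h t ω - F t ω ^ 2 / h t ω := by
              rw [hW]
              field_simp
              ring
          _ ≤ _ := by
              have : 0 ≤ F t ω ^ 2 / h t ω := by positivity
              linarith
      have i1 := (hU t ht'.le).integrable le_top
      have i2 := hWn.integrable le_top
      have i12 : Integrable (fun ω => N ω ^ 2 / h t ω + W ω * (F t ω - g t ω)) Pr := i1.add i2
      have i3 := (hgq t ht').integrable le_top
      calc _ ≤ ∫ ω, N ω ^ 2 / h t ω + W ω * (F t ω - g t ω) + g t ω ^ 2 / h t ω ∂Pr :=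
            integral_mono ((hU _ ht).integrable le_top) (i12.add i3) hpt
        _ = (∫ ω, N ω ^ 2 / h t ω ∂Pr) + ∫ ω, g t ω ^ 2 / h t ω ∂Pr := by
            rw [integral_add i12 i3, integral_add i1 i2, horth t ht' W hWm hWb, add_zero]
        _ ≤ _ := by
            simp only [Finset.sum_range_succ]
            rw [integral_add (hsum.integrable le_top) i3]
            exact add_le_add_left (ih ht'.le) _
  exact key T le_rfl

/-! ### The filtration of the samples and adaptedness of the iterates -/

/-- The σ-algebra generated by the samples before iteration `t` of epoch `k`. -/
@[reducible] def pastSigma {Ω Ξ : Type*} [MeasurableSpace Ξ] (ξ : ℕ → ℕ → Ω → Ξ) (k t : ℕ) :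
    MeasurableSpace Ω :=
  ⨆ p ∈ {p : ℕ × ℕ | p.1 < k ∨ p.1 = k ∧ p.2 < t}, MeasurableSpace.comap (ξ p.1 p.2) inferInstance

section Past

variable {Ω Ξ : Type*} [MeasurableSpace Ξ] {ξ : ℕ → ℕ → Ω → Ξ}

lemma pastSigma_mono_iteration (k : ℕ) : Monotone (pastSigma ξ k) := fun _ _ h =>
  biSup_mono fun _ hp => hp.imp id fun hp => ⟨hp.1, hp.2.trans_le h⟩

lemma pastSigma_le_next_epoch (k t : ℕ) : pastSigma ξ k t ≤ pastSigma ξ (k + 1) 0 :=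
  biSup_mono fun p hp => Or.inl (by rcases hp with hp | hp <;> omega)

lemma measurable_sample (k t : ℕ) : Measurable[pastSigma ξ k (t + 1)] (ξ k t) := by
  refine Measurable.mono (comap_measurable _) ?_ le_rfl
  exact le_biSup (fun p : ℕ × ℕ => MeasurableSpace.comap (ξ p.1 p.2) inferInstance)
    (i := (k, t)) (Or.inr ⟨rfl, Nat.lt_succ_self t⟩)

lemma pastSigma_le [mΩ : MeasurableSpace Ω] (hξ : ∀ k t, Measurable (ξ k t)) (k t : ℕ) : pastSigma ξ k t ≤ mΩ :=
  iSup₂_le fun p _ => (hξ p.1 p.2).comap_le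

lemma indep_pastSigma [MeasurableSpace Ω] {Pr : Measure Ω} (hξ : ∀ k t, Measurable (ξ k t))
    (hind : iIndepFun (fun i : ℕ × ℕ => ξ i.1 i.2) Pr) (k t : ℕ) :
    Indep (pastSigma ξ k t) (MeasurableSpace.comap (ξ k t) inferInstance) Pr := by
  have h := indep_iSup_of_disjoint (m := fun p : ℕ × ℕ =>
    MeasurableSpace.comap (ξ p.1 p.2) inferInstance) (fun p => (hξ p.1 p.2).comap_le) hind
    (S := {p : ℕ × ℕ | p.1 < k ∨ p.1 = k ∧ p.2 < t}) (T := {(k, t)}) (by simp)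
  simpa only [iSup_singleton] using h

end Past

section Epoch

variable {d d' : ℕ} {Ω Ξ : Type*} [MeasurableSpace Ξ] {Gx : Vec d → Vec d' → Ξ → Vec d}
  {Gy : Vec d → Vec d' → Ξ → Vec d'} {Y : Set (Vec d')} {δ γ η : ℝ}

lemma measurable_proxGrad (hx : Measurable fun q : (Vec d × Vec d') × Ξ => Gx q.1.1 q.1.2 q.2)
    (hy : Measurable fun q : (Vec d × Vec d') × Ξ => Gy q.1.1 q.1.2 q.2) :
    Measurable fun q : (JointVec d d' × JointVec d d') × Ξ =>
      proxGrad Gx Gy γ (xPart q.1.1) q.1.2 q.2 := by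
  have h1 : Measurable fun q : (JointVec d d' × JointVec d d') × Ξ =>
      ((xPart q.1.2, yPart q.1.2), q.2) :=
    ((continuous_xPart.measurable.comp measurable_fst.snd).prodMk
      (continuous_yPart.measurable.comp measurable_fst.snd)).prodMk measurable_snd
  have h2 := hx.comp h1
  have h3 := hy.comp h1
  have h4 : Measurable fun q : (JointVec d d' × JointVec d d') × Ξ =>
      γ • (xPart q.1.2 - xPart q.1.1) :=
    ((continuous_xPart.measurable.comp measurable_fst.snd).sub
      (continuous_xPart.measurable.comp measurable_fst.fst)).const_smul γ
  have h5 : Continuous fun p : Vec d × Vec d' => joinVec p.1 p.2 := by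
    unfold joinVec
    refine (PiLp.continuous_toLp 2 _).comp (continuous_pi fun i => ?_)
    cases i <;> simp only [Sum.elim_inl, Sum.elim_inr] <;> fun_prop
  exact h5.measurable.comp ((h2.add h4).prodMk h3.neg)

lemma continuous_adaStep (hY : IsClosed Y) (hYc : Convex ℝ Y) (hne : (feasible d Y).Nonempty)
    (hδ : 0 < δ) : Continuous fun p : JointVec d d' × (Fin d ⊕ Fin d' → ℝ) × JointVec d d' =>
      daStep (feasible d Y) (η • p.1) (fun i => δ + √(p.2.1 i)) p.2.2 :=
  continuous_daStep (isClosed_feasible hY) (convex_feasible hYc) hne hδ (by fun_prop)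
    (by fun_prop) (by fun_prop) fun _ _ => le_add_of_nonneg_right (Real.sqrt_nonneg _)

/-- The AdaGrad iterates and gradients are adapted to the filtration of the samples. -/
lemma measurable_adaState {m : ℕ → MeasurableSpace Ω} (hmono : Monotone m)
    (hx : Measurable fun q : (Vec d × Vec d') × Ξ => Gx q.1.1 q.1.2 q.2)
    (hy : Measurable fun q : (Vec d × Vec d') × Ξ => Gy q.1.1 q.1.2 q.2)
    (hY : IsClosed Y) (hYc : Convex ℝ Y) (hne : (feasible d Y).Nonempty) (hδ : 0 < δ)
    {s : ℕ → Ω → Ξ} (hs : ∀ t, Measurable[m (t + 1)] (s t)) {z₀ : Ω → JointVec d d'}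
    (hz₀ : Measurable[m 0] z₀) (t : ℕ) :
    (Measurable[m t] fun ω => (adaState (proxGrad Gx Gy γ (xPart (z₀ ω))) Y δ η (z₀ ω)
      (fun t => s t ω) t).point) ∧
    (Measurable[m t] fun ω => (adaState (proxGrad Gx Gy γ (xPart (z₀ ω))) Y δ η (z₀ ω)
      (fun t => s t ω) t).gradSum) ∧
    (Measurable[m t] fun ω => (adaState (proxGrad Gx Gy γ (xPart (z₀ ω))) Y δ η (z₀ ω)
      (fun t => s t ω) t).sqSum) ∧
    (Measurable[m (t + 1)] fun ω => adaGradient (proxGrad Gx Gy γ (xPart (z₀ ω))) Y δ η (z₀ ω)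
      (fun t => s t ω) t) := by
  have hgrad : ∀ t, (Measurable[m t] fun ω => (adaState (proxGrad Gx Gy γ (xPart (z₀ ω))) Y δ η
      (z₀ ω) (fun t => s t ω) t).point) →
      Measurable[m (t + 1)] fun ω => adaGradient (proxGrad Gx Gy γ (xPart (z₀ ω))) Y δ η (z₀ ω)
        (fun t => s t ω) t := fun t h =>
    (measurable_proxGrad hx hy).comp (((hz₀.mono (hmono (Nat.zero_le _)) le_rfl).prodMk
      (h.mono (hmono (Nat.le_succ t)) le_rfl)).prodMk (hs t))
  induction t with
  | zero => exact ⟨hz₀, measurable_const, measurable_const, hgrad 0 hz₀⟩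
  | succ t ih =>
    obtain ⟨h1, h2, h3, h4⟩ := ih
    have hle : m t ≤ m (t + 1) := hmono (Nat.le_succ t)
    have h2' := (h2.mono hle le_rfl).add h4
    have hi : ∀ i, Continuous fun z : JointVec d d' => z i := fun i => by fun_prop
    have h3' : Measurable[m (t + 1)] fun ω => (adaState (proxGrad Gx Gy γ (xPart (z₀ ω))) Y δ η
        (z₀ ω) (fun t => s t ω) (t + 1)).sqSum := by
      refine @measurable_pi_lambda Ω _ _ (m (t + 1)) _ _ fun i => ?_
      have a1 := (measurable_pi_apply i).comp (h3.mono hle le_rfl)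
      have a2 := (hi i).measurable.comp h4
      exact a1.add (a2.pow_const 2)
    have h1' : Measurable[m (t + 1)] fun ω => (adaState (proxGrad Gx Gy γ (xPart (z₀ ω))) Y δ η
        (z₀ ω) (fun t => s t ω) (t + 1)).point := by
      have e : (fun ω => (adaState (proxGrad Gx Gy γ (xPart (z₀ ω))) Y δ η
          (z₀ ω) (fun t => s t ω) (t + 1)).point) = (fun p : JointVec d d' ×
          (Fin d ⊕ Fin d' → ℝ) × JointVec d d' =>
            daStep (feasible d Y) (η • p.1) (fun i => δ + √(p.2.1 i)) p.2.2) ∘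
          fun ω => ((adaState (proxGrad Gx Gy γ (xPart (z₀ ω))) Y δ η (z₀ ω)
            (fun t => s t ω) (t + 1)).gradSum, (adaState (proxGrad Gx Gy γ (xPart (z₀ ω))) Y δ η
            (z₀ ω) (fun t => s t ω) (t + 1)).sqSum, z₀ ω) := by
        funext ω
        rw [adaState_point_succ]
        rfl
      rw [e]
      exact (continuous_adaStep hY hYc hne hδ).measurable.comp
        (h2'.prodMk (h3'.prodMk (hz₀.mono (hmono (Nat.zero_le _)) le_rfl)))
    exact ⟨h1', h2', h3', hgrad _ h1'⟩

/-- Bounded gradients keep the iterates bounded. -/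
lemma norm_adaState_point_le {Ξ : Type*} {G : JointVec d d' → Ξ → JointVec d d'} {z₀ : JointVec d d'}
    {s : ℕ → Ξ} (hY : IsClosed Y) (hYc : Convex ℝ Y) (hδ : 0 < δ) (hz₀ : z₀ ∈ feasible d Y)
    {T : ℕ} (hb : ∀ t < T, ∀ i, |adaGradient G Y δ η z₀ s t i| ≤ δ) {t : ℕ} (ht : t ≤ T) :
    ‖(adaState G Y δ η z₀ s t).point - z₀‖ ≤ |η| * (T * (d + d')) := by
  have hg : ∀ t < T, ‖adaGradient G Y δ η z₀ s t‖ ≤ (d + d') * δ := by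
    intro t ht
    refine le_of_sq_le_sq ?_ (by positivity)
    rw [EuclideanSpace.real_norm_sq_eq]
    have h1 : ∑ i, adaGradient G Y δ η z₀ s t i ^ 2 ≤ ∑ _i : Fin d ⊕ Fin d', δ ^ 2 :=
      Finset.sum_le_sum fun i _ => sq_le_sq.2 ((hb t ht i).trans (le_abs_self δ))
    have h2 : ((d + d' : ℕ) : ℝ) ≤ ((d + d' : ℕ) : ℝ) ^ 2 := by
      exact_mod_cast Nat.le_self_pow two_ne_zero _
    rw [Finset.sum_const, Finset.card_univ, Fintype.card_sum, Fintype.card_fin, Fintype.card_fin,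
      nsmul_eq_mul] at h1
    push_cast at h1 h2
    rw [mul_pow]
    exact h1.trans (mul_le_mul_of_nonneg_right h2 (sq_nonneg δ))
  have hsum : ∀ t ≤ T, ‖(adaState G Y δ η z₀ s t).gradSum‖ ≤ t * ((d + d') * δ) := by
    intro t
    induction t with
    | zero => simp [adaState]
    | succ t ih =>
      intro ht
      rw [adaState_gradSum_succ]
      refine (norm_add_le _ _).trans ?_
      push_cast
      linarith [ih (Nat.le_of_succ_le ht), hg t ht]
  cases t with
  | zero => simp [adaState]; positivity
  | succ t =>
    rw [adaState_point_succ]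
    refine (norm_daStep_sub_center_le (isClosed_feasible hY) (convex_feasible hYc) hδ _
      (le_adaDiag _) hz₀).trans ?_
    rw [div_le_iff₀ hδ, norm_smul, Real.norm_eq_abs]
    have h1 := hsum _ ht
    have h2 : ((t + 1 : ℕ) : ℝ) ≤ T := by exact_mod_cast ht
    calc _ ≤ |η| * ((t + 1 : ℕ) * ((d + d') * δ)) := by gcongr
      _ ≤ |η| * (T * ((d + d') * δ)) := by gcongr
      _ = _ := by ring

end Epoch

/-! ### The expected error of one epoch -/

/-- Mean and integrability of the error term of AdaGrad, in coordinates. -/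
lemma integral_normalised_error_le {Ω ι : Type*} [Fintype ι] [mΩ : MeasurableSpace Ω]
    {Pr : Measure Ω} [IsProbabilityMeasure Pr] {m : ℕ → MeasurableSpace Ω} (hmono : Monotone m)
    (hm : ∀ t, m t ≤ mΩ) {δ η B : ℝ} (hδ : 0 < δ) (hη : 0 < η) {g F h W : ℕ → ι → Ω → ℝ} {T : ℕ}
    (hg : ∀ t < T, ∀ i, Measurable[m (t + 1)] (g t i))
    (hgb : ∀ t < T, ∀ i, MemLp (g t i) ⊤ Pr)
    (hF : ∀ t < T, ∀ i, Measurable[m t] (F t i)) (hFb : ∀ t < T, ∀ i, MemLp (F t i) ⊤ Pr)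
    (hh : ∀ t i, Measurable[m t] (h t i)) (hhδ : ∀ t i ω, δ ≤ h t i ω)
    (hhm : ∀ t i ω, h t i ω ≤ h (t + 1) i ω)
    (hW : ∀ t < T, ∀ i, Measurable[m t] (W t i)) (hWb : ∀ t < T, ∀ i, MemLp (W t i) ⊤ Pr)
    (horth : ∀ t < T, ∀ i, ∀ V : Ω → ℝ, Measurable[m t] V → MemLp V ⊤ Pr →
      ∫ ω, V ω * (F t i ω - g t i ω) ∂Pr = 0)
    (hB : ∀ᵐ ω ∂Pr, ∑ t ∈ Finset.range T, ∑ i, g t i ω ^ 2 / h t i ω ≤ 2 * B) :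
    Integrable (fun ω => (η / 2 * (∑ t ∈ Finset.range T, ∑ i, g t i ω ^ 2 / h t i ω +
      ∑ i, (∑ t ∈ Finset.range T, (F t i ω - g t i ω)) ^ 2 / h T i ω) +
      ∑ t ∈ Finset.range T, ∑ i, W t i ω * (F t i ω - g t i ω)) / T) Pr ∧
    ∫ ω, (η / 2 * (∑ t ∈ Finset.range T, ∑ i, g t i ω ^ 2 / h t i ω +
      ∑ i, (∑ t ∈ Finset.range T, (F t i ω - g t i ω)) ^ 2 / h T i ω) +
      ∑ t ∈ Finset.range T, ∑ i, W t i ω * (F t i ω - g t i ω)) / T ∂Pr ≤ 2 * η * B / T := by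
  have hmart := fun i => martingale_sq_div_le hmono hm hδ (fun t ht => hg t ht i)
    (fun t ht => hgb t ht i) (fun t ht => hF t ht i) (fun t ht => hFb t ht i)
    (fun t _ => hh t i) (fun t => hhδ t i) (fun t => hhm t i) (fun t ht => horth t ht i)
  have hgq : ∀ t < T, ∀ i, Integrable (fun ω => g t i ω ^ 2 / h t i ω) Pr := fun t ht i => by
    refine (memLp_top_div_of_le hδ ?_ ((hh t i).mono (hm t) le_rfl) (hhδ t i)).integrable le_top
    simp only [sq]
    exact (hgb t ht i).mul' (hgb t ht i) (r := ⊤)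
  have hWn : ∀ t < T, ∀ i, Integrable (fun ω => W t i ω * (F t i ω - g t i ω)) Pr :=
    fun t ht i => (((hFb t ht i).sub (hgb t ht i)).mul' (hWb t ht i) (r := ⊤)).integrable le_top
  have i1 : Integrable (fun ω => ∑ t ∈ Finset.range T, ∑ i, g t i ω ^ 2 / h t i ω) Pr :=
    integrable_finsetSum _ fun t ht => integrable_finsetSum _ fun i _ =>
      hgq t (Finset.mem_range.1 ht) i
  have i2 : Integrable (fun ω =>
      ∑ i, (∑ t ∈ Finset.range T, (F t i ω - g t i ω)) ^ 2 / h T i ω) Pr :=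
    integrable_finsetSum _ fun i _ => (hmart i).1.integrable le_top
  have i3 : Integrable (fun ω =>
      ∑ t ∈ Finset.range T, ∑ i, W t i ω * (F t i ω - g t i ω)) Pr :=
    integrable_finsetSum _ fun t ht => integrable_finsetSum _ fun i _ =>
      hWn t (Finset.mem_range.1 ht) i
  have i12 := (i1.add i2).const_mul (η / 2)
  refine ⟨(i12.add i3).div_const _, ?_⟩
  have e1 : ∫ ω, ∑ t ∈ Finset.range T, ∑ i, g t i ω ^ 2 / h t i ω ∂Pr ≤ 2 * B := by
    refine (integral_mono_ae i1 (integrable_const _) hB).trans ?_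
    simp
  have e2 : ∫ ω, ∑ i, (∑ t ∈ Finset.range T, (F t i ω - g t i ω)) ^ 2 / h T i ω ∂Pr ≤ 2 * B := by
    refine le_trans ?_ e1
    rw [integral_finsetSum _ fun i _ => (hmart i).1.integrable le_top]
    refine (Finset.sum_le_sum fun i _ => (hmart i).2).trans_eq ?_
    rw [← integral_finsetSum]
    · exact integral_congr_ae (Filter.Eventually.of_forall fun ω => Finset.sum_comm)
    · exact fun i _ => integrable_finsetSum _ fun t ht => hgq t (Finset.mem_range.1 ht) i
  have e3 : ∫ ω, ∑ t ∈ Finset.range T, ∑ i, W t i ω * (F t i ω - g t i ω) ∂Pr = 0 := by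
    rw [integral_finsetSum _ fun t ht => integrable_finsetSum _ fun i _ =>
      hWn t (Finset.mem_range.1 ht) i]
    refine Finset.sum_eq_zero fun t ht => ?_
    have ht' := Finset.mem_range.1 ht
    rw [integral_finsetSum _ fun i _ => hWn t ht' i]
    exact Finset.sum_eq_zero fun i _ => horth t ht' i _ (hW t ht' i) (hWb t ht' i)
  rw [integral_div]
  refine div_le_div_of_nonneg_right ?_ (Nat.cast_nonneg T)
  have e4 := integral_add i12 i3
  have e5 := integral_add i1 i2
  simp only [Pi.add_apply] at e4 e5
  rw [e4, integral_const_mul, e5, e3]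
  have := mul_le_mul_of_nonneg_left (add_le_add e1 e2) (half_pos hη).le
  linarith

section EpochError

variable {d d' : ℕ} {Ω Ξ : Type*} [mΩ : MeasurableSpace Ω] [MeasurableSpace Ξ] {Pr : Measure Ω}
  [IsProbabilityMeasure Pr] {f : Vec d → Vec d' → ℝ} {Y : Set (Vec d')}
  {Gx : Vec d → Vec d' → Ξ → Vec d} {Gy : Vec d → Vec d' → Ξ → Vec d'} {ξ : ℕ → ℕ → Ω → Ξ}

/-- The contribution of the proximal term to the coordinates of the gradient. -/
def proxShift (ρ : ℝ) (z₀ z : JointVec d d') (i : Fin d ⊕ Fin d') : ℝ :=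
  Sum.elim (fun _ => 2 * ρ * (z i - z₀ i)) (fun _ => 0) i

lemma abs_proxShift_le {ρ : ℝ} (hρ : 0 < ρ) (z₀ z : JointVec d d') (i : Fin d ⊕ Fin d') :
    |proxShift ρ z₀ z i| ≤ 2 * ρ * ‖z - z₀‖ := by
  cases i with
  | inl j =>
    rw [proxShift, Sum.elim_inl, abs_mul, abs_of_pos (by positivity : 0 < 2 * ρ)]
    gcongr
    exact PiLp.norm_apply_le (z - z₀) _
  | inr j =>
    rw [proxShift, Sum.elim_inr, abs_zero]
    positivity

lemma measurable_proxShift (ρ : ℝ) (i : Fin d ⊕ Fin d') :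
    Measurable fun p : JointVec d d' × JointVec d d' => proxShift ρ p.1 p.2 i := by
  cases i with
  | inl j =>
    simp only [proxShift, Sum.elim_inl]
    exact Continuous.measurable (by fun_prop)
  | inr j => exact measurable_const

/-- The proximal shift is the same in the stochastic gradient and in its mean, so it cancels from
the noise. What remains depends only on the query point and the sample, the form needed by
`unbiased_sampling`. -/
lemma UnbiasedOracle.coordinate {Pr : Measure Ω} (hO : UnbiasedOracle f Y Gx Gy ξ Pr) (ρ : ℝ) (k t : ℕ)
    (i : Fin d ⊕ Fin d') :
    ∃ (φ : (Vec d × Vec d') × Ξ → ℝ) (u : Vec d × Vec d' → ℝ), Measurable φ ∧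
      (∀ q ∈ {q : Vec d × Vec d' | q.2 ∈ Y}, ∫ ω, φ (q, ξ k t ω) ∂Pr = u q) ∧
      ∀ z₀ z : JointVec d d',
        (∀ s, proxGrad Gx Gy (2 * ρ) (xPart z₀) z s i =
          φ ((xPart z, yPart z), s) + proxShift ρ z₀ z i) ∧
        proxField f ρ (xPart z₀) z i = u (xPart z, yPart z) + proxShift ρ z₀ z i := by
  cases i with
  | inl j =>
    have hc : Continuous fun v : Vec d => v j := by fun_prop
    refine ⟨fun q => Gx q.1.1 q.1.2 q.2 j, fun q => gradX f q.1 q.2 j,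
      hc.measurable.comp hO.measX, fun q hq => ?_, fun z₀ z => ⟨fun s => ?_, ?_⟩⟩
    · simp only [← hO.unbiasedX k t q.1 q.2 hq]
      exact (EuclideanSpace.proj (𝕜 := ℝ) j).integral_comp_comm (hO.integrableX k t q.1 q.2 hq)
    · simp [proxGrad, joinVec, proxShift, xPart]
    · simp [proxField, joinVec, proxShift, xPart]
  | inr j =>
    have hc : Continuous fun v : Vec d' => v j := by fun_prop
    refine ⟨fun q => -Gy q.1.1 q.1.2 q.2 j, fun q => -gradY f q.1 q.2 j,
      (hc.measurable.comp hO.measY).neg, fun q hq => ?_, fun z₀ z => ⟨fun s => ?_, ?_⟩⟩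
    · simp only [← hO.unbiasedY k t q.1 q.2 hq, integral_neg]
      congr 1
      exact (EuclideanSpace.proj (𝕜 := ℝ) j).integral_comp_comm (hO.integrableY k t q.1 q.2 hq)
    · simp [proxGrad, joinVec, proxShift]
    · simp [proxField, joinVec, proxShift]

/-- Adaptedness, boundedness and orthogonality of the noise of the stochastic gradient at an adapted
bounded point. -/
lemma UnbiasedOracle.noise_spec (hO : UnbiasedOracle f Y Gx Gy ξ Pr) {ρ : ℝ} (hρ : 0 < ρ)
    (k t : ℕ) {z₀ z : Ω → JointVec d d'} (hz₀ : Measurable[pastSigma ξ k t] z₀)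
    (hz : Measurable[pastSigma ξ k t] z) (hzY : ∀ ω, z ω ∈ feasible d Y) {B δ : ℝ}
    (hB : ∀ᵐ ω ∂Pr, ‖z ω - z₀ ω‖ ≤ B)
    (hδ : ∀ᵐ ω ∂Pr, ∀ i, |proxGrad Gx Gy (2 * ρ) (xPart (z₀ ω)) (z ω) (ξ k t ω) i| ≤ δ)
    (i : Fin d ⊕ Fin d') :
    Measurable[pastSigma ξ k t] (fun ω => proxField f ρ (xPart (z₀ ω)) (z ω) i) ∧
      MemLp (fun ω => proxField f ρ (xPart (z₀ ω)) (z ω) i) ⊤ Pr ∧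
      ∀ W : Ω → ℝ, Measurable[pastSigma ξ k t] W → MemLp W ⊤ Pr →
        ∫ ω, W ω * (proxField f ρ (xPart (z₀ ω)) (z ω) i -
          proxGrad Gx Gy (2 * ρ) (xPart (z₀ ω)) (z ω) (ξ k t ω) i) ∂Pr = 0 := by
  obtain ⟨φ, u, hφ, hu, hspec⟩ := hO.coordinate ρ k t i
  have hm := pastSigma_le hO.measSample k t
  have he : Measurable[pastSigma ξ k t] fun ω => (xPart (z ω), yPart (z ω)) :=
    (continuous_xPart.measurable.comp hz).prodMk (continuous_yPart.measurable.comp hz)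
  have hsh : Measurable[pastSigma ξ k t] fun ω => proxShift ρ (z₀ ω) (z ω) i :=
    (measurable_proxShift ρ i).comp (hz₀.prodMk hz)
  -- The assumed bound `δ` is on the full proximal gradient; bounded displacement turns it into a
  -- bound on the oracle part.
  have hC : ∀ᵐ ω ∂Pr, |φ ((xPart (z ω), yPart (z ω)), ξ k t ω)| ≤ δ + 2 * ρ * B := by
    filter_upwards [hB, hδ] with ω h1 h2
    have h3 := h2 i
    rw [(hspec (z₀ ω) (z ω)).1] at h3
    have h4 := abs_proxShift_le hρ (z₀ ω) (z ω) i
    have h5 : 2 * ρ * ‖z ω - z₀ ω‖ ≤ 2 * ρ * B := by gcongr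
    have h6 := abs_sub_abs_le_abs_sub (φ ((xPart (z ω), yPart (z ω)), ξ k t ω))
      (-proxShift ρ (z₀ ω) (z ω) i)
    rw [abs_neg, sub_neg_eq_add] at h6
    linarith
  obtain ⟨h1, h2, h3⟩ := unbiased_sampling hm (hO.measSample k t)
    (indep_pastSigma hO.measSample hO.indep k t) he hφ (S := {q | q.2 ∈ Y}) hzY hu hC
  have e1 : (fun ω => proxField f ρ (xPart (z₀ ω)) (z ω) i) =
      fun ω => u (xPart (z ω), yPart (z ω)) + proxShift ρ (z₀ ω) (z ω) i :=
    funext fun ω => (hspec _ _).2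
  refine ⟨e1 ▸ h1.add hsh, ?_, fun W hW hWb => ?_⟩
  · rw [e1]
    refine (memLp_top_of_bound (h1.mono hm le_rfl).aestronglyMeasurable _ h2).add
      (memLp_top_of_bound (hsh.mono hm le_rfl).aestronglyMeasurable (2 * ρ * B) ?_)
    filter_upwards [hB] with ω h
    refine (abs_proxShift_le hρ (z₀ ω) (z ω) i).trans ?_
    gcongr
  · rw [← h3 W hW hWb]
    refine integral_congr_ae (Filter.Eventually.of_forall fun ω => ?_)
    simp only [(hspec (z₀ ω) (z ω)).1, (hspec (z₀ ω) (z ω)).2, add_sub_add_right_eq_sub]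

/-- The expected error of one epoch. -/
theorem UnbiasedOracle.integral_adaError_le (hO : UnbiasedOracle f Y Gx Gy ξ Pr) {ρ δ η S : ℝ}
    (hρ : 0 < ρ) (hY : IsClosed Y) (hYc : Convex ℝ Y) (hδ : 0 < δ) (hη : 0 < η) (k T : ℕ)
    {z₀ : Ω → JointVec d d'} (hz₀ : Measurable[pastSigma ξ k 0] z₀)
    (hfeas : ∀ ω, z₀ ω ∈ feasible d Y)
    (hb : ∀ t < T, ∀ᵐ ω ∂Pr, ∀ i, |adaGradient (proxGrad Gx Gy (2 * ρ) (xPart (z₀ ω))) Y δ η (z₀ ω)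
      (fun t => ξ k t ω) t i| ≤ δ)
    (hS : ∀ᵐ ω ∂Pr, ∀ i, √((adaState (proxGrad Gx Gy (2 * ρ) (xPart (z₀ ω))) Y δ η (z₀ ω)
      (fun t => ξ k t ω) T).sqSum i) ≤ S) :
    Integrable (fun ω => adaError (proxField f ρ (xPart (z₀ ω)))
      (proxGrad Gx Gy (2 * ρ) (xPart (z₀ ω))) Y δ η (z₀ ω) (fun t => ξ k t ω) T) Pr ∧
    ∫ ω, adaError (proxField f ρ (xPart (z₀ ω)))
      (proxGrad Gx Gy (2 * ρ) (xPart (z₀ ω))) Y δ η (z₀ ω) (fun t => ξ k t ω) T ∂Pr ≤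
        2 * η * ((d + d') * S) / T := by
  have hne : (feasible d Y).Nonempty := by
    obtain ⟨ω⟩ := nonempty_of_isProbabilityMeasure Pr
    exact ⟨_, hfeas ω⟩
  have hst := measurable_adaState (γ := 2 * ρ) (η := η) (pastSigma_mono_iteration (ξ := ξ) k)
    hO.measX hO.measY hY hYc hne hδ (fun t => measurable_sample k t) hz₀
  have hm := pastSigma_le hO.measSample k
  have hb' : ∀ᵐ ω ∂Pr, ∀ t < T, ∀ i, |adaGradient (proxGrad Gx Gy (2 * ρ) (xPart (z₀ ω))) Y δ η
      (z₀ ω) (fun t => ξ k t ω) t i| ≤ δ := by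
    rw [ae_all_iff]
    intro t
    by_cases ht : t < T
    · filter_upwards [hb t ht] with ω hω _ using hω
    · exact Filter.Eventually.of_forall fun ω h => absurd h ht
  -- Only the existence of a deterministic bound matters: it gives essential boundedness and does
  -- not enter the final estimate.
  have hdist : ∀ t ≤ T, ∀ᵐ ω ∂Pr, ‖(adaState (proxGrad Gx Gy (2 * ρ) (xPart (z₀ ω))) Y δ η (z₀ ω)
      (fun t => ξ k t ω) t).point - z₀ ω‖ ≤ |η| * (T * (d + d')) := fun t ht => by
    filter_upwards [hb'] with ω hω using norm_adaState_point_le hY hYc hδ (hfeas ω) hω ht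
  have hpY : ∀ t ω, (adaState (proxGrad Gx Gy (2 * ρ) (xPart (z₀ ω))) Y δ η (z₀ ω)
      (fun t => ξ k t ω) t).point ∈ feasible d Y :=
    fun t ω => (adaState_point_spec hY hδ (hfeas ω) t).1
  have hbound := fun ω => @adaGrad_sum_sq_div_le _ _ _
    (proxGrad Gx Gy (2 * ρ) (xPart (z₀ ω))) Y δ η (z₀ ω) (fun t => ξ k t ω) hδ T
  have hdm := fun ω => @adaDiag_mono _ _ _
    (proxGrad Gx Gy (2 * ρ) (xPart (z₀ ω))) Y δ η (z₀ ω) (fun t => ξ k t ω)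
  have hdl := fun ω => @le_adaDiag _ _ _
    (proxGrad Gx Gy (2 * ρ) (xPart (z₀ ω))) Y δ η (z₀ ω) (fun t => ξ k t ω)
  have hdmeas : ∀ t i, Measurable[pastSigma ξ k t] fun ω =>
      adaDiag (proxGrad Gx Gy (2 * ρ) (xPart (z₀ ω))) Y δ η (z₀ ω) (fun t => ξ k t ω) t i := by
    intro t i
    have := (measurable_pi_apply i).comp (hst t).2.2.1
    exact (this.sqrt).const_add δ
  have hgr : ∀ t i, Measurable[pastSigma ξ k (t + 1)] fun ω =>
      adaGradient (proxGrad Gx Gy (2 * ρ) (xPart (z₀ ω))) Y δ η (z₀ ω) (fun t => ξ k t ω) t i := by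
    intro t i
    have hc : Continuous fun z : JointVec d d' => z i := by fun_prop
    exact hc.measurable.comp (hst t).2.2.2
  have hW : ∀ t i, Measurable[pastSigma ξ k t] fun ω =>
      ((adaState (proxGrad Gx Gy (2 * ρ) (xPart (z₀ ω))) Y δ η (z₀ ω)
      (fun t => ξ k t ω) t).point - z₀ ω) i := by
    intro t i
    have hc : Continuous fun z : JointVec d d' => z i := by fun_prop
    exact hc.measurable.comp ((hst t).1.sub
      (hz₀.mono (pastSigma_mono_iteration k (Nat.zero_le t)) le_rfl))
  have hspec : ∀ t < T, ∀ i, _ := fun t ht i => hO.noise_spec hρ k t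
    (hz₀.mono (pastSigma_mono_iteration k (Nat.zero_le t)) le_rfl) (hst t).1 (hpY t)
    (hdist t ht.le) (hb t ht) i
  simp only [adaError, adaNoise, PiLp.sub_apply, EuclideanSpace.real_inner_eq_sum] at hW ⊢
  have hbgr : ∀ t < T, ∀ i, ∀ᵐ ω ∂Pr, |adaGradient (proxGrad Gx Gy (2 * ρ) (xPart (z₀ ω))) Y δ η
      (z₀ ω) (fun t => ξ k t ω) t i| ≤ δ := fun t ht i => by
    filter_upwards [hb t ht] with ω hω using hω i
  have hbW : ∀ t < T, ∀ i, ∀ᵐ ω ∂Pr,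
      |(adaState (proxGrad Gx Gy (2 * ρ) (xPart (z₀ ω))) Y δ η (z₀ ω)
      (fun t => ξ k t ω) t).point i - z₀ ω i| ≤ |η| * (T * (d + d')) := fun t ht i => by
    filter_upwards [hdist t ht.le] with ω hω using (PiLp.norm_apply_le (_ - z₀ ω) i).trans hω
  have hboundS : ∀ᵐ ω ∂Pr, ∑ t ∈ Finset.range T, ∑ i,
      adaGradient (proxGrad Gx Gy (2 * ρ) (xPart (z₀ ω))) Y δ η (z₀ ω) (fun t => ξ k t ω) t i ^ 2 /
      adaDiag (proxGrad Gx Gy (2 * ρ) (xPart (z₀ ω))) Y δ η (z₀ ω) (fun t => ξ k t ω) t i ≤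
      2 * ((d + d') * S) := by
    filter_upwards [hb', hS] with ω h1 h2
    refine (hbound ω h1).trans ?_
    gcongr
    refine (Finset.sum_le_sum fun i _ => h2 i).trans ?_
    simp
  exact integral_normalised_error_le (pastSigma_mono_iteration k) hm hδ hη
    (fun t _ i => hgr t i)
    (fun t ht i => memLp_top_of_bound ((hgr t i).mono (hm _) le_rfl).aestronglyMeasurable δ
      (hbgr t ht i))
    (fun t ht i => (hspec t ht i).1) (fun t ht i => (hspec t ht i).2.1) hdmeas
    (fun t i ω => hdl ω t i) (fun t i ω => hdm ω t i) (fun t _ i => hW t i)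
    (fun t ht i => memLp_top_of_bound ((hW t i).mono (hm _) le_rfl).aestronglyMeasurable _
      (hbW t ht i))
    (fun t ht i => (hspec t ht i).2.2) hboundS

end EpochError

/-! ### The outer loop in expectation -/

section OuterLoop

variable {d d' : ℕ} {Ω Ξ : Type*} [mΩ : MeasurableSpace Ω] [MeasurableSpace Ξ] {Pr : Measure Ω}
  {f : Vec d → Vec d' → ℝ} {Y : Set (Vec d')} {ℓ L ρ μ μy μx ε₀ : ℝ} {x₀ : Vec d} {y₀ : Vec d'}
  {Gx : Vec d → Vec d' → Ξ → Vec d} {Gy : Vec d → Vec d' → Ξ → Vec d'} {ξ : ℕ → ℕ → Ω → Ξ}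
  {δ γ α : ℝ} {η : ℕ → ℝ} {T : ℕ → ℕ}

/-- `P` is continuous, and `y ↦ inf_x f(x, y)` is an infimum of functions continuous on `Y`, hence
upper semicontinuous there. -/
lemma MinMaxAssumptions.measurable_dualityGap
    (hA : MinMaxAssumptions f Y ℓ L ρ μ μy μx ε₀ x₀ y₀) {z : Ω → JointVec d d'}
    (hz : Measurable z) (hzY : ∀ ω, z ω ∈ feasible d Y) :
    Measurable fun ω => dualityGap f Y (xPart (z ω)) (yPart (z ω)) := by
  have h1 : Measurable fun ω => primal f Y (xPart (z ω)) :=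
    hA.primalDiff.continuous.measurable.comp (continuous_xPart.measurable.comp hz)
  have h2 : UpperSemicontinuous fun y : Y => ⨅ x, f x y := by
    refine upperSemicontinuous_ciInf (fun y => ?_) fun x =>
      ((hA.continuousOn_y x).domRestrict).upperSemicontinuous
    obtain ⟨-, xt, hxt, -⟩ := hA.xSidePL y y.2
    exact ⟨f xt y, by rintro _ ⟨x, rfl⟩; exact hxt x⟩
  have h3 : Measurable fun ω => (⟨yPart (z ω), hzY ω⟩ : Y) :=
    (continuous_yPart.measurable.comp hz).subtype_mk
  exact h1.sub (h2.measurable.comp h3)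

lemma pesAdaGrad_mem_feasible {Ξ : Type*} {Gx : Vec d → Vec d' → Ξ → Vec d}
    {Gy : Vec d → Vec d' → Ξ → Vec d'} {s : ℕ → ℕ → Ξ} (hY : IsClosed Y) (hYc : Convex ℝ Y) (hδ : 0 < δ)
    (hT : ∀ k, 0 < T k) (hy₀ : y₀ ∈ Y) (k : ℕ) :
    pesAdaGrad Gx Gy Y δ γ η T x₀ y₀ s k ∈ feasible d Y := by
  induction k with
  | zero => exact hy₀
  | succ k ih => exact adaOutput_mem_feasible hY hYc hδ ih (hT k)

lemma measurable_pesAdaGrad {Ω : Type*} {ξ : ℕ → ℕ → Ω → Ξ}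
    (hx : Measurable fun q : (Vec d × Vec d') × Ξ => Gx q.1.1 q.1.2 q.2)
    (hy : Measurable fun q : (Vec d × Vec d') × Ξ => Gy q.1.1 q.1.2 q.2)
    (hY : IsClosed Y) (hYc : Convex ℝ Y) (hy₀ : y₀ ∈ Y) (hδ : 0 < δ) (k : ℕ) :
    Measurable[pastSigma ξ k 0]
      fun ω => pesAdaGrad Gx Gy Y δ γ η T x₀ y₀ (fun k t => ξ k t ω) k := by
  induction k with
  | zero => exact measurable_const
  | succ k ih =>
    have h := measurable_adaState (γ := γ) (η := η k) (pastSigma_mono_iteration (ξ := ξ) k)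
      hx hy hY hYc ⟨joinVec x₀ y₀, hy₀⟩ hδ (fun t => measurable_sample k t) ih
    have hsum : Measurable[pastSigma ξ (k + 1) 0] fun ω => ∑ t ∈ Finset.range (T k),
        (adaState (proxGrad Gx Gy γ (xPart (pesAdaGrad Gx Gy Y δ γ η T x₀ y₀
          (fun k t => ξ k t ω) k))) Y δ (η k) (pesAdaGrad Gx Gy Y δ γ η T x₀ y₀
          (fun k t => ξ k t ω) k) (fun t => ξ k t ω) t).point :=
      Finset.measurable_sum _ fun t _ => (h t).1.mono (pastSigma_le_next_epoch k t) le_rfl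
    exact hsum.const_smul (1 / (T k : ℝ))

/-- The potential along the epochs is dominated by integrable random variables whose means satisfy
the deterministic recursion. -/
theorem exists_integrable_potential_bound [IsProbabilityMeasure Pr]
    (hA : MinMaxAssumptions f Y ℓ L ρ μ μy μx ε₀ x₀ y₀) (hO : UnbiasedOracle f Y Gx Gy ξ Pr)
    {K : ℕ} (hG : GradientGrowth Gx Gy Y δ (2 * ρ) α η T x₀ y₀ ξ Pr K)
    (hρ : 0 < ρ) (hμ : 0 < μ) (hμy : 0 < μy) (hμx : 0 < μx) (hδ : 0 < δ) (hα : 0 < α)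
    (hε₀ : 0 ≤ ε₀) (hη : ∀ k, 0 < η k) (hT : ∀ k, 0 < T k)
    (hTη : ∀ k, 40000 * (δ * (T k : ℝ) ^ α) ≤ η k * T k * min ρ μy) {E : ℕ → ℝ}
    (hE₀ : 2 * ε₀ ≤ E 0)
    (hE : ∀ k, (1 - proxRate ρ (max μ μx)) * E k +
      41 / 400000 * (η k ^ 2 * ((d + d') * min ρ μy)) ≤ E (k + 1)) :
    ∀ k ≤ K, ∃ D : Ω → ℝ, Integrable D Pr ∧ ∫ ω, D ω ∂Pr ≤ E k ∧
      ∀ᵐ ω ∂Pr, potential f Y ρ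
        (xPart (pesAdaGrad Gx Gy Y δ (2 * ρ) η T x₀ y₀ (fun k t => ξ k t ω) k))
        (yPart (pesAdaGrad Gx Gy Y δ (2 * ρ) η T x₀ y₀ (fun k t => ξ k t ω) k)) ≤ D ω := by
  have hm0 : 0 < min ρ μy := lt_min hρ hμy
  have hν : 0 < max μ μx := lt_max_of_lt_left hμ
  have hθ1 : 0 ≤ 1 - proxRate ρ (max μ μx) := by
    rw [proxRate, sub_nonneg, div_le_one (by positivity)]
    linarith
  have hfeas := fun k ω => pesAdaGrad_mem_feasible (Gx := Gx) (Gy := Gy) (γ := 2 * ρ) (η := η)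
    (x₀ := x₀) (s := fun k t => ξ k t ω) hA.closed hA.convex hδ hT hA.start_mem k
  intro k
  induction k with
  | zero =>
    intro _
    refine ⟨fun _ => 2 * ε₀, integrable_const _, by simpa using hE₀,
      Filter.Eventually.of_forall fun ω => ?_⟩
    exact hA.potential_start_le hρ hμy hε₀
  | succ k ih =>
    intro hk
    obtain ⟨D, hDi, hDE, hD⟩ := ih (Nat.le_of_succ_le hk)
    have hT' : (0 : ℝ) < T k := by exact_mod_cast hT k
    have hTα : 1 ≤ (T k : ℝ) ^ α := Real.one_le_rpow (by exact_mod_cast hT k) hα.le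
    obtain ⟨hRi, hRE⟩ := hO.integral_adaError_le (S := δ * (T k : ℝ) ^ α) hρ hA.closed hA.convex hδ
      (hη k) k (T k) (measurable_pesAdaGrad (γ := 2 * ρ) (η := η) (T := T) (x₀ := x₀)
        hO.measX hO.measY hA.closed hA.convex hA.start_mem hδ k)
      (hfeas k) (hG.bounded k hk) (hG.growth k hk)
    -- The dominating variable follows the pathwise recursion: contract the old one and add `41/20`
    -- of the epoch error. No measurability of the potential itself is required.
    refine ⟨_, (hDi.const_mul (1 - proxRate ρ (max μ μx))).add (hRi.const_mul (41 / 20)), ?_, ?_⟩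
    · have e := integral_add (hDi.const_mul (1 - proxRate ρ (max μ μx))) (hRi.const_mul (41 / 20))
      simp only [Pi.add_apply] at e ⊢
      rw [e, integral_const_mul, integral_const_mul]
      refine le_trans ?_ (hE k)
      have h1 : 2 * η k * ((d + d') * (δ * (T k : ℝ) ^ α)) / T k ≤
          1 / 20000 * (η k ^ 2 * ((d + d') * min ρ μy)) := by
        rw [div_le_iff₀ hT']
        have : 0 ≤ 2 * η k * ((d : ℝ) + d') / 40000 := by have := hη k; positivity
        have := mul_le_mul_of_nonneg_left (hTη k) this
        linarith
      have h2 := mul_le_mul_of_nonneg_left hDE hθ1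
      linarith
    · filter_upwards [hD, hG.growth k hk] with ω h1 h2
      have h3 := hA.potential_step hρ hμ hμy hμx (xc := xPart (pesAdaGrad Gx Gy Y δ (2 * ρ) η T x₀ y₀
        (fun k t => ξ k t ω) k)) (hfeas k ω) (hfeas (k + 1) ω)
        (fun x y hy => (hA.adaGrad_gap_le hρ hμy (B := 1 / 20000 * min ρ μy) hδ (hη k) (hfeas k ω)
          (hT k) (fun i => ?_) x hy).trans_eq (by rw [mul_assoc]))
      · refine h3.trans (add_le_add_left (mul_le_mul_of_nonneg_left h1 hθ1) _)
      · have h4 := h2 i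
        have h5 := hTη k
        have h6 : δ ≤ δ * (T k : ℝ) ^ α := le_mul_of_one_le_right hδ.le hTα
        -- As `δ ≤ δ T^α`, the diagonal is at most `2δT^α`; this is why the epoch-length constant is
        -- `40000 = 2 · 20000`.
        calc _ ≤ δ + δ * (T k : ℝ) ^ α := by
              unfold adaDiag
              exact add_le_add_right h4 _
          _ ≤ _ := by linarith

/-- The expected duality gap of the output. -/
theorem integral_dualityGap_le [IsProbabilityMeasure Pr]
    (hA : MinMaxAssumptions f Y ℓ L ρ μ μy μx ε₀ x₀ y₀) (hO : UnbiasedOracle f Y Gx Gy ξ Pr)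
    {K : ℕ} (hG : GradientGrowth Gx Gy Y δ (2 * ρ) α η T x₀ y₀ ξ Pr K)
    (hρ : 0 < ρ) (hμ : 0 < μ) (hμy : 0 < μy) (hμx : 0 < μx) (hδ : 0 < δ) (hα : 0 < α)
    (hε₀ : 0 ≤ ε₀) (hη : ∀ k, 0 < η k) (hT : ∀ k, 0 < T k)
    (hTη : ∀ k, 40000 * (δ * (T k : ℝ) ^ α) ≤ η k * T k * min ρ μy) {E : ℕ → ℝ}
    (hE₀ : 2 * ε₀ ≤ E 0)
    (hE : ∀ k, (1 - proxRate ρ (max μ μx)) * E k +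
      41 / 400000 * (η k ^ 2 * ((d + d') * min ρ μy)) ≤ E (k + 1)) :
    Integrable (fun ω => dualityGap f Y
      (xPart (pesAdaGrad Gx Gy Y δ (2 * ρ) η T x₀ y₀ (fun k t => ξ k t ω) K))
      (yPart (pesAdaGrad Gx Gy Y δ (2 * ρ) η T x₀ y₀ (fun k t => ξ k t ω) K))) Pr ∧
    ∫ ω, dualityGap f Y
      (xPart (pesAdaGrad Gx Gy Y δ (2 * ρ) η T x₀ y₀ (fun k t => ξ k t ω) K))
      (yPart (pesAdaGrad Gx Gy Y δ (2 * ρ) η T x₀ y₀ (fun k t => ξ k t ω) K)) ∂Pr ≤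
        2400 * (ρ / μx + 1) * E K := by
  obtain ⟨D, hDi, hDE, hD⟩ := exists_integrable_potential_bound hA hO hG hρ hμ hμy hμx hδ hα hε₀ hη
    hT hTη hE₀ hE K le_rfl
  have hfeas := fun ω => pesAdaGrad_mem_feasible (Gx := Gx) (Gy := Gy) (γ := 2 * ρ) (η := η)
    (x₀ := x₀) (s := fun k t => ξ k t ω) hA.closed hA.convex hδ hT hA.start_mem K
  have hχ : 0 ≤ 2400 * (ρ / μx + 1) := by positivity
  have hle : ∀ᵐ ω ∂Pr, dualityGap f Y
      (xPart (pesAdaGrad Gx Gy Y δ (2 * ρ) η T x₀ y₀ (fun k t => ξ k t ω) K))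
      (yPart (pesAdaGrad Gx Gy Y δ (2 * ρ) η T x₀ y₀ (fun k t => ξ k t ω) K)) ≤
        2400 * (ρ / μx + 1) * D ω := by
    filter_upwards [hD] with ω hω
    exact (hA.dualityGap_le_potential hρ hμy hμx _ (hfeas ω)).trans
      (mul_le_mul_of_nonneg_left hω hχ)
  have hi : Integrable (fun ω => dualityGap f Y
      (xPart (pesAdaGrad Gx Gy Y δ (2 * ρ) η T x₀ y₀ (fun k t => ξ k t ω) K))
      (yPart (pesAdaGrad Gx Gy Y δ (2 * ρ) η T x₀ y₀ (fun k t => ξ k t ω) K))) Pr := by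
    refine (hDi.const_mul (2400 * (ρ / μx + 1))).mono' (hA.measurable_dualityGap
      ((measurable_pesAdaGrad hO.measX hO.measY hA.closed hA.convex hA.start_mem hδ K).mono
        (pastSigma_le hO.measSample K 0) le_rfl) hfeas).aestronglyMeasurable ?_
    filter_upwards [hle] with ω hω
    rwa [Real.norm_of_nonneg (hA.dualityGap_nonneg hμy _ (hfeas ω))]
  refine ⟨hi, (integral_mono_ae hi (hDi.const_mul _) hle).trans ?_⟩
  rw [integral_const_mul]
  exact mul_le_mul_of_nonneg_left hDE hχ

end OuterLoop

/-! ### The schedule, the iteration count and the final accuracy -/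

/-- The exponent `2 μ / (c + 2 μ)` of the step size schedule. -/
def scheduleRate (L ρ μ : ℝ) : ℝ := 2 * μ / ((4 * ρ + 248 / 53 * (L + 2 * ρ)) + 2 * μ)

section Schedule

variable {L ρ μ : ℝ}

lemma scheduleRate_pos (hρ : 0 < ρ) (hμ : 0 < μ) (hL : μ ≤ L) : 0 < scheduleRate L ρ μ := by
  have : 0 < L := hμ.trans_le hL
  unfold scheduleRate
  positivity

lemma two_div_scheduleRate_le (hρ : 0 < ρ) (hμ : 0 < μ) (hL : μ ≤ L) :
    2 / scheduleRate L ρ μ ≤ 14 * ((L + ρ) / μ) := by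
  have : 0 < L := hμ.trans_le hL
  unfold scheduleRate
  rw [div_div_eq_mul_div, mul_div_assoc', mul_div_mul_left _ _ two_ne_zero]
  gcongr
  linarith

/-- The potential contracts faster than the squared step sizes decrease. -/
lemma one_le_proxRate_sub_scheduleRate {ν : ℝ} (hρ : 0 < ρ) (hμ : 0 < μ) (hL : μ ≤ L)
    (hν : μ ≤ ν) : 1 ≤ (proxRate ρ ν - scheduleRate L ρ μ) * (115 * (ρ / ν + 1)) := by
  have hν0 : 0 < ν := hμ.trans_le hν
  have hL0 : 0 < L := hμ.trans_le hL
  -- Replacing `L` by `μ` in `c` leaves a rate increasing in `μ`, so `μ` may become `ν`; the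
  -- coefficients are rounded down.
  have h1 : scheduleRate L ρ μ ≤ 100 * ν / (665 * ρ + 330 * ν) := by
    unfold scheduleRate
    rw [div_le_div_iff₀ (by positivity) (by positivity)]
    have h1 : μ * ρ ≤ ν * ρ := by gcongr
    have h2 : ν * μ ≤ ν * L := by gcongr
    nlinarith [mul_pos hν0 hρ, mul_pos hν0 hμ]
  have h2 : ν / (115 * (ρ + ν)) ≤ proxRate ρ ν - 100 * ν / (665 * ρ + 330 * ν) := by
    have e : proxRate ρ ν - 100 * ν / (665 * ρ + 330 * ν) =
        ν * (12585 * ρ + 1170 * ν) / ((200 * ρ + 150 * ν) * (665 * ρ + 330 * ν)) := by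
      unfold proxRate
      field_simp
      ring
    rw [e, div_le_div_iff₀ (by positivity) (by positivity), mul_assoc]
    refine mul_le_mul_of_nonneg_left ?_ hν0.le
    nlinarith [mul_pos hρ hν0, sq_nonneg ρ, sq_nonneg ν]
  have h3 : ν / (115 * (ρ + ν)) * (115 * (ρ / ν + 1)) = 1 := by
    field_simp
  exact h3.symm.le.trans (mul_le_mul_of_nonneg_right (by linarith) (by positivity))

lemma stepSize_sq (η₀ : ℝ) (k : ℕ) :
    stepSize L ρ μ η₀ k ^ 2 = η₀ ^ 2 * Real.exp (-(scheduleRate L ρ μ * k)) := by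
  rw [stepSize, mul_pow, ← Real.exp_nat_mul, scheduleRate]
  congr 2
  push_cast
  ring

lemma stepSize_pos {η₀ : ℝ} (hη₀ : 0 < η₀) (k : ℕ) : 0 < stepSize L ρ μ η₀ k :=
  mul_pos hη₀ (Real.exp_pos _)

/-- The deterministic recursion for the mean of the potential. -/
lemma potential_recursion {ν ε₀ V η₀ : ℝ} (hρ : 0 < ρ) (hμ : 0 < μ) (hL : μ ≤ L) (hν : μ ≤ ν)
    (hε₀ : 0 ≤ ε₀) (hV : 0 ≤ V) (k : ℕ) :
    (1 - proxRate ρ ν) * (Real.exp (-(scheduleRate L ρ μ * k)) *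
        (2 * ε₀ + (ρ / ν + 1) * (η₀ ^ 2 * V))) +
      41 / 400000 * (stepSize L ρ μ η₀ k ^ 2 * V) ≤
    Real.exp (-(scheduleRate L ρ μ * (k + 1 : ℕ))) *
      (2 * ε₀ + (ρ / ν + 1) * (η₀ ^ 2 * V)) := by
  have hν0 : 0 < ν := hμ.trans_le hν
  have h1 := one_le_proxRate_sub_scheduleRate hρ hμ hL hν
  rw [stepSize_sq]
  generalize scheduleRate L ρ μ = q at *
  have h2 : Real.exp (-(q * (k + 1 : ℕ))) = Real.exp (-(q * k)) * Real.exp (-q) := by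
    rw [← Real.exp_add]
    push_cast
    ring_nf
  have h3 : 1 - q ≤ Real.exp (-q) := by linarith [Real.add_one_le_exp (-q)]
  have hW : 0 ≤ η₀ ^ 2 * V := by positivity
  rw [h2]
  generalize hWd : η₀ ^ 2 * V = W at *
  have h4 : 0 ≤ 2 * ε₀ + (ρ / ν + 1) * W := by positivity
  have h5 := mul_le_mul_of_nonneg_right h3 h4
  have h6 := mul_le_mul_of_nonneg_right h1 hW
  have h7 : 0 ≤ proxRate ρ ν - q := by
    by_contra hneg
    have : (proxRate ρ ν - q) * (115 * (ρ / ν + 1)) ≤ 0 :=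
      mul_nonpos_of_nonpos_of_nonneg (not_le.1 hneg).le (by positivity)
    linarith
  have h8 : 0 ≤ (proxRate ρ ν - q) * ε₀ := mul_nonneg h7 hε₀
  -- The margin between the two rates, times `ρ/ν + 1`, is at least `1/115`, which exceeds the noise
  -- coefficient `41/400000`.
  have h9 : (1 - proxRate ρ ν) * (2 * ε₀ + (ρ / ν + 1) * W) + 41 / 400000 * W ≤
      Real.exp (-q) * (2 * ε₀ + (ρ / ν + 1) * W) := by nlinarith
  have h10 := mul_le_mul_of_nonneg_left h9 (Real.exp_pos (-(q * k))).le
  have e : 41 / 400000 * (η₀ ^ 2 * Real.exp (-(q * k)) * V) =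
      Real.exp (-(q * k)) * (41 / 400000 * W) := by
    rw [← hWd]
    ring
  rw [e]
  linarith

/-- The sums satisfy `S_{K+1} = exp(-x)(S_K + 1)`, and `1/x + 1 = (x + 1)/x ≤ exp(x)/x`. -/
lemma sum_exp_le {x : ℝ} (hx : 0 < x) (K : ℕ) :
    ∑ k ∈ Finset.range K, Real.exp (-(x * ((K : ℝ) - k))) ≤ 1 / x := by
  induction K with
  | zero => simp [hx.le]
  | succ K ih =>
    have e : ∀ k : ℕ, Real.exp (-(x * (((K + 1 : ℕ) : ℝ) - k))) =
        Real.exp (-x) * Real.exp (-(x * ((K : ℝ) - k))) := fun k => by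
      rw [← Real.exp_add]
      push_cast
      ring_nf
    simp only [e]
    rw [← Finset.mul_sum, Finset.sum_range_succ, sub_self, mul_zero, neg_zero, Real.exp_zero,
      Real.exp_neg, inv_mul_le_iff₀ (Real.exp_pos x)]
    have h1 := Real.add_one_le_exp x
    calc _ ≤ 1 / x + 1 := by linarith
      _ = (x + 1) * (1 / x) := by field_simp; ring
      _ ≤ _ := by gcongr

lemma epochLength_spec {A μy δ α η₀ : ℝ} (hA : 0 < A) (hρ : 0 < ρ) (hμy : 0 < μy) (hδ : 0 < δ)
    (hα' : α ≤ 1 / 2) (hη₀ : 0 < η₀) (k : ℕ) :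
    0 < epochLength A L ρ μ μy δ α η₀ k ∧
      A * (δ * (epochLength A L ρ μ μy δ α η₀ k : ℝ) ^ α) ≤
        stepSize L ρ μ η₀ k * epochLength A L ρ μ μy δ α η₀ k * min ρ μy := by
  have hm : 0 < min ρ μy := lt_min hρ hμy
  have hη := stepSize_pos (L := L) (ρ := ρ) (μ := μ) hη₀ k
  have hX : 0 < A * δ / (stepSize L ρ μ η₀ k * min ρ μy) := by positivity
  have hpos : 0 < epochLength A L ρ μ μy δ α η₀ k := Nat.ceil_pos.2 (Real.rpow_pos_of_pos hX _)
  refine ⟨hpos, ?_⟩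
  have hle : (A * δ / (stepSize L ρ μ η₀ k * min ρ μy)) ^ (1 / (1 - α)) ≤
      epochLength A L ρ μ μy δ α η₀ k := Nat.le_ceil _
  have hT : (0 : ℝ) < epochLength A L ρ μ μy δ α η₀ k := by exact_mod_cast hpos
  generalize (epochLength A L ρ μ μy δ α η₀ k : ℝ) = T at *
  have h1 : A * δ / (stepSize L ρ μ η₀ k * min ρ μy) ≤ T ^ (1 - α) := by
    have := Real.rpow_le_rpow (by positivity) hle (by linarith : 0 ≤ 1 - α)
    rwa [← Real.rpow_mul hX.le, one_div_mul_cancel (by linarith), Real.rpow_one] at this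
  have h2 : T = T ^ (1 - α) * T ^ α := by
    rw [← Real.rpow_add hT, sub_add_cancel, Real.rpow_one]
  rw [div_le_iff₀ (by positivity)] at h1
  have h3 := mul_le_mul_of_nonneg_right h1 (Real.rpow_nonneg hT.le α)
  calc _ = A * δ * T ^ α := by ring
    _ ≤ _ := h3
    _ = stepSize L ρ μ η₀ k * (T ^ (1 - α) * T ^ α) * min ρ μy := by ring
    _ = _ := by rw [← h2]

/-- The total number of iterations for a step size with prescribed last value. -/
lemma sum_epochLength_le {A μy δ α η₀ w M : ℝ} {K : ℕ} (hA : 0 < A) (hρ : 0 < ρ) (hμ : 0 < μ)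
    (hL : μ ≤ L) (hμy : 0 < μy) (hδ : 0 < δ) (hα : 0 < α) (hα' : α ≤ 1 / 2) (hη₀ : 0 < η₀)
    (hw : 0 < w) (hηw : η₀ ^ 2 = Real.exp (scheduleRate L ρ μ * K) * w)
    (hM : (A * δ) ^ 2 / (w * min ρ μy ^ 2) = M) :
    ((∑ k ∈ Finset.range K, epochLength A L ρ μ μy δ α η₀ k : ℕ) : ℝ) ≤
      K + 2 / scheduleRate L ρ μ * M ^ (1 / (2 * (1 - α))) := by
  have hm : 0 < min ρ μy := lt_min hρ hμy
  have hq := scheduleRate_pos hρ hμ hL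
  have hM0 : 0 < M := by rw [← hM]; positivity
  have h1α : 0 < 1 - α := by linarith
  have hb : 1 / 2 ≤ 1 / (2 * (1 - α)) := by
    rw [div_le_div_iff₀ (by norm_num) (by positivity)]
    linarith
  -- The term `1` pays for the ceiling. The exponential has rate `2b · q/2` with `b = 1/(2(1-α)) ≥
  -- 1/2`, hence at least `q/2`.
  have hterm : ∀ k ∈ Finset.range K, (epochLength A L ρ μ μy δ α η₀ k : ℝ) ≤
      1 + Real.exp (-(scheduleRate L ρ μ / 2 * ((K : ℝ) - k))) * M ^ (1 / (2 * (1 - α))) := by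
    intro k hk
    have hkK : (k : ℝ) ≤ K := by exact_mod_cast (Finset.mem_range.1 hk).le
    have hη := stepSize_pos (L := L) (ρ := ρ) (μ := μ) hη₀ k
    have hX : 0 ≤ A * δ / (stepSize L ρ μ η₀ k * min ρ μy) := by positivity
    have hceil := (Nat.ceil_lt_add_one (Real.rpow_nonneg hX (1 / (1 - α)))).le
    rw [add_comm] at hceil
    refine hceil.trans (add_le_add_right ?_ 1)
    have e1 : 1 / (1 - α) = 2 * (1 / (2 * (1 - α))) := by field_simp
    have e2 : (A * δ / (stepSize L ρ μ η₀ k * min ρ μy)) ^ 2 =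
        Real.exp (-(scheduleRate L ρ μ * ((K : ℝ) - k))) * M := by
      rw [div_pow, mul_pow (stepSize L ρ μ η₀ k), stepSize_sq, hηw, ← hM]
      have : Real.exp (-(scheduleRate L ρ μ * ((K : ℝ) - k))) *
          (Real.exp (scheduleRate L ρ μ * K) * Real.exp (-(scheduleRate L ρ μ * k))) = 1 := by
        rw [← Real.exp_add, ← Real.exp_add, ← Real.exp_zero]
        ring_nf
      rw [← div_eq_one_iff_eq (by positivity)]
      field_simp
      linarith
    rw [e1, Real.rpow_mul hX, Real.rpow_two, e2, Real.mul_rpow (Real.exp_pos _).le hM0.le,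
      ← Real.exp_mul]
    gcongr
    have : 0 ≤ scheduleRate L ρ μ * ((K : ℝ) - k) := mul_nonneg hq.le (by linarith)
    nlinarith
  push_cast
  refine (Finset.sum_le_sum hterm).trans ?_
  rw [Finset.sum_add_distrib, ← Finset.sum_mul]
  have h1 := sum_exp_le (half_pos hq) K
  have e : 1 / (scheduleRate L ρ μ / 2) = 2 / scheduleRate L ρ μ := by field_simp
  rw [e] at h1
  have h2 := mul_le_mul_of_nonneg_right h1 (Real.rpow_nonneg hM0.le (1 / (2 * (1 - α))))
  simp only [Finset.sum_const, Finset.card_range, nsmul_eq_mul, mul_one]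
  linarith

/-- Interpolation between the two condition numbers. -/
lemma rpow_condition_le {b χ χe κ Q : ℝ} (hb : 1 / 2 ≤ b) (hb' : b ≤ 1) (hχe : 1 ≤ χe)
    (h1 : χe ≤ χ) (h2 : χe ≤ κ) (hQ : 0 ≤ Q) :
    κ * (χ * χe * Q) ^ b ≤ χ * (κ ^ 2 * Q) ^ b := by
  have hχ : 0 < χ := by linarith
  have hκ : 0 < κ := by linarith
  have hχe0 : 0 < χe := by linarith
  rw [Real.mul_rpow (by positivity) hQ, Real.mul_rpow hχ.le hχe0.le,
    Real.mul_rpow (by positivity) hQ]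
  suffices h : κ * (χ ^ b * χe ^ b) ≤ χ * (κ ^ 2) ^ b by
    have := mul_le_mul_of_nonneg_right h (Real.rpow_nonneg hQ b)
    linarith
  have e1 : χe ^ b = χe ^ (1 - b) * χe ^ (2 * b - 1) := by
    rw [← Real.rpow_add hχe0]; ring_nf
  have e2 : χ = χ ^ b * χ ^ (1 - b) := by
    rw [← Real.rpow_add hχ]; simp
  have e3 : (κ ^ 2) ^ b = κ * κ ^ (2 * b - 1) := by
    rw [← Real.rpow_two, ← Real.rpow_mul hκ.le]
    nth_rw 2 [← Real.rpow_one κ]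
    rw [← Real.rpow_add hκ]; ring_nf
  rw [e1, e3]
  -- Both exponents are nonnegative since `1/2 ≤ b ≤ 1`, so one power of `χe` is traded for `χ` and
  -- the other for `κ`.
  calc κ * (χ ^ b * (χe ^ (1 - b) * χe ^ (2 * b - 1)))
      ≤ κ * (χ ^ b * (χ ^ (1 - b) * κ ^ (2 * b - 1))) := by
        gcongr
        linarith
    _ = χ ^ b * χ ^ (1 - b) * (κ * κ ^ (2 * b - 1)) := by ring
    _ = _ := by rw [← e2]

lemma le_exp_ceil_log_div {r q : ℝ} (hr : 0 ≤ r) (hq : 0 < q) :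
    1 + 9600 * r ≤ Real.exp (q * ⌈Real.log (1 + 9600 * r) / q⌉₊) := by
  rw [← Real.log_le_iff_le_exp (by positivity)]
  have := Nat.le_ceil (Real.log (1 + 9600 * r) / q)
  rw [div_le_iff₀ hq] at this
  linarith

lemma ceil_log_div_le {r q κ : ℝ} (hr : 0 ≤ r) (hq : 0 < q) (hκ : 1 ≤ κ)
    (hqκ : 2 / q ≤ 14 * κ) :
    (⌈Real.log (1 + 9600 * r) / q⌉₊ : ℝ) ≤ 67201 * κ * (1 + Real.log (1 + r)) := by
  have hlog : 0 ≤ Real.log (1 + 9600 * r) := Real.log_nonneg (by linarith)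
  have hell : 0 ≤ Real.log (1 + r) := Real.log_nonneg (by linarith)
  have h1 : Real.log (1 + 9600 * r) ≤ 9600 + Real.log (1 + r) := by
    calc _ ≤ Real.log (9600 * (1 + r)) := Real.log_le_log (by positivity) (by linarith)
      _ = Real.log 9600 + Real.log (1 + r) := Real.log_mul (by norm_num) (by positivity)
      _ ≤ _ := by linarith [Real.log_le_self (show (0 : ℝ) ≤ 9600 by norm_num)]
  have h2 := (Nat.ceil_lt_add_one (div_nonneg hlog hq.le)).le
  have h3 : Real.log (1 + 9600 * r) / q ≤ (9600 + Real.log (1 + r)) * (7 * κ) := by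
    have : (1 : ℝ) / q ≤ 7 * κ := by
      have e : (2 : ℝ) / q = 2 * (1 / q) := by ring
      rw [e] at hqκ
      linarith
    calc _ = Real.log (1 + 9600 * r) * (1 / q) := by ring
      _ ≤ _ := by gcongr
  have h4 : 0 ≤ κ * Real.log (1 + r) := by positivity
  linarith

/-- The iteration complexity in terms of the condition numbers. -/
lemma complexity_le {b χ χe κ Q q ell K : ℝ} (hb : 1 / 2 ≤ b) (hb' : b ≤ 1) (hχe : 1 ≤ χe)
    (h1 : χe ≤ χ) (h2 : χe ≤ κ) (hQ : 1 ≤ Q) (hq : 2 / q ≤ 14 * κ) (hell : 0 ≤ ell)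
    (hK : K ≤ 67201 * κ * (1 + ell)) :
    K + 2 / q * (4800 * 40000 ^ 2 * (χ * χe * Q)) ^ b ≤
      (67200 * 40000 ^ 2 + 67201) * (1 + ell) * (χ * (κ ^ 2 * Q) ^ b) := by
  have hκ : 1 ≤ κ := hχe.trans h2
  have hχ : 1 ≤ χ := hχe.trans h1
  have hrec := rpow_condition_le hb hb' hχe h1 h2 (by linarith : 0 ≤ Q)
  have h3 : (4800 * 40000 ^ 2 * (χ * χe * Q)) ^ b ≤ 4800 * 40000 ^ 2 * (χ * χe * Q) ^ b := by
    rw [Real.mul_rpow (by norm_num) (by positivity)]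
    gcongr
    exact Real.rpow_le_self_of_one_le (by norm_num) hb'
  have h4 : κ ≤ χ * (κ ^ 2 * Q) ^ b := by
    have h5 : κ ≤ (κ ^ 2 * Q) ^ b := by
      calc κ = (κ ^ 2) ^ (1 / 2 : ℝ) := by
            rw [← Real.sqrt_eq_rpow, Real.sqrt_sq (by linarith)]
        _ ≤ (κ ^ 2 * Q) ^ (1 / 2 : ℝ) := by
            gcongr
            exact le_mul_of_one_le_right (by positivity) hQ
        _ ≤ _ := Real.rpow_le_rpow_of_exponent_le
          (one_le_mul_of_one_le_of_one_le (one_le_pow₀ hκ) hQ) hb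
    exact h5.trans (le_mul_of_one_le_left (by positivity) hχ)
  have h6 : 2 / q * (4800 * 40000 ^ 2 * (χ * χe * Q)) ^ b ≤
      67200 * 40000 ^ 2 * (χ * (κ ^ 2 * Q) ^ b) := by
    calc _ ≤ 14 * κ * (4800 * 40000 ^ 2 * (χ * χe * Q) ^ b) := by gcongr
      _ = 67200 * 40000 ^ 2 * (κ * (χ * χe * Q) ^ b) := by ring
      _ ≤ _ := by gcongr
  generalize χ * (κ ^ 2 * Q) ^ b = Z at *
  have h7 : κ * (1 + ell) ≤ Z * (1 + ell) := by gcongr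
  have h8 : Z ≤ Z * (1 + ell) := le_mul_of_one_le_right (by linarith) (by linarith)
  linarith

/-- The accuracy reached for the prescribed last step size. -/
lemma accuracy_le {χ χe ε₀ ε V X : ℝ} (hχ : 0 < χ) (hχe : 0 < χe) (hε : 0 < ε) (hV : 0 < V)
    (hX : 0 < X) (hlow : 1 + 9600 * (χ * ε₀ / ε) ≤ X) :
    2400 * χ * (X⁻¹ * (2 * ε₀ + χe * (X * (ε / (4800 * χ * χe * V)) * V))) ≤ ε := by
  have e : 2400 * χ * (X⁻¹ * (2 * ε₀ + χe * (X * (ε / (4800 * χ * χe * V)) * V))) =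
      4800 * χ * ε₀ / X + ε / 2 := by
    field_simp
    ring
  rw [e]
  have h1 : 4800 * χ * ε₀ / X ≤ ε / 2 := by
    rw [div_le_iff₀ hX]
    have h2 := mul_le_mul_of_nonneg_left hlow hε.le
    have h3 : ε * (1 + 9600 * (χ * ε₀ / ε)) = ε + 9600 * (χ * ε₀) := by field_simp
    linarith
  linarith

end Schedule

end

theorem mainTheorem10 :
    ∃ (A C : ℝ) (p : ℕ), 0 < A ∧ 0 < C ∧
      ∀ (d d' : ℕ) (L ρ μ μy μx δ α ε₀ ε : ℝ),
        0 < d + d' → 0 < ρ → 0 < μ → μ ≤ L → 0 < μy → 0 < μx → 0 < δ →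
        0 < α → α ≤ 1 / 2 → 0 ≤ ε₀ → 0 < ε → min ρ μy * ε ≤ δ ^ 2 * ((d : ℝ) + d') →
        ∃ (η₀ : ℝ) (K : ℕ), 0 < η₀ ∧
          -- the total number of iterations
          ((∑ k ∈ Finset.range K, epochLength A L ρ μ μy δ α η₀ k : ℕ) : ℝ) ≤
            C * (1 + Real.log (1 + (ρ / μx + 1) * ε₀ / ε)) ^ p *
              ((ρ / μx + 1) *
                (δ ^ 2 * (L + ρ) ^ 2 * ((d : ℝ) + d') / (μ ^ 2 * min ρ μy * ε)) ^
                  (1 / (2 * (1 - α)))) ∧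
          -- the expected duality gap of the output
          ∀ (Ω Ξ : Type*) [MeasurableSpace Ω] [MeasurableSpace Ξ]
            (Pr : Measure Ω) [IsProbabilityMeasure Pr]
            (f : Vec d → Vec d' → ℝ) (Y : Set (Vec d')) (ℓ : ℝ)
            (x₀ : Vec d) (y₀ : Vec d')
            (Gx : Vec d → Vec d' → Ξ → Vec d) (Gy : Vec d → Vec d' → Ξ → Vec d')
            (ξ : ℕ → ℕ → Ω → Ξ),
            MinMaxAssumptions f Y ℓ L ρ μ μy μx ε₀ x₀ y₀ →
            UnbiasedOracle f Y Gx Gy ξ Pr →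
            GradientGrowth Gx Gy Y δ (2 * ρ) α (stepSize L ρ μ η₀)
              (epochLength A L ρ μ μy δ α η₀) x₀ y₀ ξ Pr K →
            let out : Ω → JointVec d d' := fun ω =>
              pesAdaGrad Gx Gy Y δ (2 * ρ) (stepSize L ρ μ η₀)
                (epochLength A L ρ μ μy δ α η₀) x₀ y₀ (fun k t => ξ k t ω) K
            Integrable (fun ω => dualityGap f Y (xPart (out ω)) (yPart (out ω))) Pr ∧
              ∫ ω, dualityGap f Y (xPart (out ω)) (yPart (out ω)) ∂Pr ≤ ε := by
  -- In `C`, `67200 = 14 · 4800` combines the bound on `2/q` with the constant in the final step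
  -- size, and `67201` pays for the number of epochs.
  refine ⟨40000, 67200 * 40000 ^ 2 + 67201, 1, by norm_num, by norm_num, ?_⟩
  intro d d' L ρ μ μy μx δ α ε₀ ε hd hρ hμ hL hμy hμx hδ hα hα' hε₀ hε hεδ
  have hm : 0 < min ρ μy := lt_min hρ hμy
  have hD : (0 : ℝ) < (d : ℝ) + d' := by exact_mod_cast hd
  have hν : 0 < max μ μx := lt_max_of_lt_left hμ
  have hq := scheduleRate_pos hρ hμ hL
  have hq2 := two_div_scheduleRate_le hρ hμ hL
  have hχe1 : 1 ≤ ρ / max μ μx + 1 := by linarith [div_pos hρ hν]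
  have hχeχ : ρ / max μ μx + 1 ≤ ρ / μx + 1 := by
    gcongr
    exact le_max_right _ _
  have hχeκ : ρ / max μ μx + 1 ≤ (L + ρ) / μ := by
    have h1 : ρ / max μ μx ≤ ρ / μ := by
      gcongr
      exact le_max_left _ _
    have h2 : 1 ≤ L / μ := (one_le_div hμ).2 hL
    rw [add_div]
    linarith
  obtain ⟨χe, hχe⟩ : ∃ χe, χe = ρ / max μ μx + 1 := ⟨_, rfl⟩
  obtain ⟨χ, hχ⟩ : ∃ χ, χ = ρ / μx + 1 := ⟨_, rfl⟩
  rw [← hχe] at hχe1 hχeχ hχeκ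
  rw [← hχ] at hχeχ ⊢
  have hχe0 : 0 < χe := by linarith
  have hχ0 : 0 < χ := by linarith
  have hr : 0 ≤ χ * ε₀ / ε := by positivity
  have hV : 0 < ((d : ℝ) + d') * min ρ μy := by positivity
  have hw0 : 0 < ε / (4800 * χ * χe * (((d : ℝ) + d') * min ρ μy)) := by positivity
  have hKlow := le_exp_ceil_log_div hr hq
  have hKup := ceil_log_div_le hr hq (hχe1.trans hχeκ) hq2
  obtain ⟨K, hK⟩ : ∃ K, K = ⌈Real.log (1 + 9600 * (χ * ε₀ / ε)) / scheduleRate L ρ μ⌉₊ :=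
    ⟨_, rfl⟩
  rw [← hK] at hKlow hKup
  -- Chosen backwards: after `K` epochs the squared step is exactly the second factor, which makes
  -- the noise contribute `ε/2` to the gap bound.
  obtain ⟨η₀, hη₀pos, hη₀sq⟩ : ∃ η₀ : ℝ, 0 < η₀ ∧ η₀ ^ 2 = Real.exp (scheduleRate L ρ μ * K) *
      (ε / (4800 * χ * χe * (((d : ℝ) + d') * min ρ μy))) :=
    ⟨√_, Real.sqrt_pos.2 (by positivity), Real.sq_sqrt (by positivity)⟩
  refine ⟨η₀, K, hη₀pos, ?_, ?_⟩
  · have h1α : 0 < 1 - α := by linarith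
    have hb1 : 1 / 2 ≤ 1 / (2 * (1 - α)) := by
      rw [div_le_div_iff₀ (by norm_num) (by positivity)]
      linarith
    have hb2 : 1 / (2 * (1 - α)) ≤ 1 := by
      rw [div_le_one (by positivity)]
      linarith
    -- The upper bound on `ε` enters here; it lets the number of epochs, of order `κ` times a
    -- logarithm, be absorbed into the main term.
    have hQ1 : 1 ≤ δ ^ 2 * ((d : ℝ) + d') / (min ρ μy * ε) := by
      rwa [one_le_div (by positivity)]
    have hQe : δ ^ 2 * (L + ρ) ^ 2 * ((d : ℝ) + d') / (μ ^ 2 * min ρ μy * ε) =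
        ((L + ρ) / μ) ^ 2 * (δ ^ 2 * ((d : ℝ) + d') / (min ρ μy * ε)) := by
      field_simp
    have hM : (40000 * δ) ^ 2 /
        (ε / (4800 * χ * χe * (((d : ℝ) + d') * min ρ μy)) * min ρ μy ^ 2) =
        4800 * 40000 ^ 2 * (χ * χe * (δ ^ 2 * ((d : ℝ) + d') / (min ρ μy * ε))) := by
      field_simp
    rw [hQe, pow_one]
    exact (sum_epochLength_le (A := 40000) (by norm_num) hρ hμ hL hμy hδ hα hα' hη₀pos hw0 hη₀sq
      hM).trans (complexity_le hb1 hb2 hχe1 hχeχ hχeκ hQ1 hq2 (Real.log_nonneg (by linarith)) hKup)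
  · intro Ω Ξ _ _ Pr _ f Y ℓ x₀ y₀ Gx Gy ξ hA hO hG
    have hspec := epochLength_spec (L := L) (μ := μ) (A := 40000) (by norm_num) hρ hμy hδ hα' hη₀pos
    have hres := integral_dualityGap_le hA hO hG hρ hμ hμy hμx hδ hα hε₀
      (fun k => stepSize_pos hη₀pos k) (fun k => (hspec k).1) (fun k => (hspec k).2)
      (E := fun k => Real.exp (-(scheduleRate L ρ μ * k)) *
        (2 * ε₀ + (ρ / max μ μx + 1) * (η₀ ^ 2 * (((d : ℝ) + d') * min ρ μy))))
      (by
        have : 0 ≤ (ρ / max μ μx + 1) * (η₀ ^ 2 * (((d : ℝ) + d') * min ρ μy)) := by positivity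
        simpa using this)
      (fun k => potential_recursion hρ hμ hL (le_max_left _ _) hε₀ hV.le k)
    refine ⟨hres.1, hres.2.trans ?_⟩
    rw [hη₀sq, Real.exp_neg, ← hχe, ← hχ]
    exact accuracy_le hχ0 hχe0 hε hV (Real.exp_pos _) hKlow
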